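/- Let $\mathcal H$ be a complex, separable, infinite-dimensional Hilbert space with orthonormal basis $\{e_n\}_{n\ge 1}$, and let $\{X_n\}_{n\ge 1}$ be nonnegative, bounded, i.i.d. random variables on a probability space $(\Omega,\mathcal F,\mathbb P)$. Let $R$ be the maximum of the essential range of $X_1$ (the support of its law), and assume $R=1$. Let $T=T(\omega)$ be the random weighted shift, i.e. the (almost surely bounded) linear operator on $\mathcal H$ with $Te_n=X_n(\omega)e_{n+1}$ for all $n\ge 1$. For a bounded operator $A\in B(\mathcal H)$, let $\mathscr A_A$, $\mathscr W_A$ and $\mathscr O_A$ (the Banach algebra, the weakly closed algebra and the dual algebra generated by $A$) be the closures of the set $\{p(A): p\in\mathbb C[z]\}$ in the norm topology, in the weak operator topology, and in the weak* topology of $B(\mathcal H)$ as the dual of the trace-class operators, respectively. Let $\{A\}'$ be the commutant of $A$ and $\{A\}''$ its double commutant (the set of bounded operators commuting with every element of $\{A\}'$). Let $\mathbb D$ be the open unit disk, let $\mathcal A(\mathbb D)$ be the disk algebra (continuous functions on $\overline{\mathbb D}$ that are holomorphic in $\mathbb D$) and let $H^\infty(\mathbb D)$ be the algebra of bounded holomorphic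 functions on $\mathbb D$, both with the supremum norm. "Isometrically isomorphic" means that there is an isometric isomorphism of complex algebras. Then: (i) Almost surely, $\mathscr A_T$ is isometrically isomorphic to $\mathcal A(\mathbb D)$. (ii) Almost surely, $\mathscr O_T=\mathscr W_T$. Moreover, if $\mathbb P(X_1=0)=0$, then almost surely $\mathscr O_T=\mathscr W_T=\{T\}'=\{T\}''$, and this algebra is isometrically isomorphic to $H^\infty(\mathbb D)$. -/

import Mathlib

open MeasureTheory ProbabilityTheory
open scoped BoundedContinuousFunction

namespace RandomShift

noncomputable section

/-- The essential range of a random variable: the support of its law. -/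
def essRange {Ω : Type*} [MeasurableSpace Ω] (X : Ω → ℝ) (P : Measure Ω) : Set ℝ :=
  (P.map X).support

section Operators

variable {H : Type*} [NormedAddCommGroup H] [InnerProductSpace ℂ H]

/-! ### Unilateral weighted shifts -/

/-- The coordinates of the image of `x` under the shift with weights `w`: `0` in position `0`,
and `w n * x n` in position `n + 1`. -/
def shiftCoord (w : ℕ → ℝ) (x : ℕ → ℂ) : ℕ → ℂ
  | 0 => 0
  | n + 1 => (w n : ℂ) * x n

theorem shiftCoord_bound {w : ℕ → ℝ} {C : ℝ} (hC : ∀ n, |w n| ≤ C)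
    (x : lp (fun _ : ℕ => ℂ) 2) :
    ∃ h : Memℓp (shiftCoord w (x : ℕ → ℂ)) 2,
      ‖(⟨shiftCoord w (x : ℕ → ℂ), h⟩ : lp (fun _ : ℕ => ℂ) 2)‖ ≤ C * ‖x‖ := by
  have hC0 : 0 ≤ C := (abs_nonneg _).trans (hC 0)
  have h2 : (0 : ℝ) < (2 : ENNReal).toReal := by norm_num
  have hx : HasSum (fun n => ‖(x : ℕ → ℂ) n‖ ^ (2 : ENNReal).toReal)
      (‖x‖ ^ (2 : ENNReal).toReal) := lp.hasSum_norm h2 x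
  simp only [ENNReal.toReal_ofNat, Real.rpow_ofNat] at hx
  have hle : ∀ n, ‖shiftCoord w (x : ℕ → ℂ) (n + 1)‖ ^ 2 ≤ C ^ 2 * ‖(x : ℕ → ℂ) n‖ ^ 2 := by
    intro n
    simp only [shiftCoord, norm_mul, Complex.norm_real, Real.norm_eq_abs, mul_pow]
    gcongr
    exact hC n
  have hs1 : Summable (fun n => ‖shiftCoord w (x : ℕ → ℂ) (n + 1)‖ ^ 2) :=
    Summable.of_nonneg_of_le (fun n => by positivity) hle (hx.summable.mul_left _)
  have hs : Summable (fun n => ‖shiftCoord w (x : ℕ → ℂ) n‖ ^ 2) :=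
    (summable_nat_add_iff (f := fun n => ‖shiftCoord w (x : ℕ → ℂ) n‖ ^ 2) 1).mp hs1
  have hmem : Memℓp (shiftCoord w (x : ℕ → ℂ)) 2 := by
    refine memℓp_gen ?_
    simpa only [ENNReal.toReal_ofNat, Real.rpow_ofNat] using hs
  refine ⟨hmem, ?_⟩
  refine lp.norm_le_of_tsum_le h2 (by positivity) ?_
  simp only [ENNReal.toReal_ofNat, Real.rpow_ofNat]
  rw [hs.tsum_eq_zero_add]
  have : ∑' n, ‖shiftCoord w (x : ℕ → ℂ) (n + 1)‖ ^ 2 ≤ C ^ 2 * ‖x‖ ^ 2 := by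
    rw [← hx.tsum_eq, ← tsum_mul_left]
    exact hs1.tsum_le_tsum hle (hx.summable.mul_left _)
  simpa [shiftCoord, mul_pow] using this

/-- The weighted shift on `ℓ²` with weights bounded by `C`. -/
def shiftLp (w : ℕ → ℝ) (C : ℝ) (hC : ∀ n, |w n| ≤ C) :
    lp (fun _ : ℕ => ℂ) 2 →L[ℂ] lp (fun _ : ℕ => ℂ) 2 :=
  LinearMap.mkContinuous
    { toFun := fun x => ⟨shiftCoord w (x : ℕ → ℂ), (shiftCoord_bound hC x).choose⟩
      map_add' := fun x y => by
        ext n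
        change shiftCoord w ((x : ℕ → ℂ) + (y : ℕ → ℂ)) n =
          shiftCoord w (x : ℕ → ℂ) n + shiftCoord w (y : ℕ → ℂ) n
        cases n <;> simp [shiftCoord, mul_add]
      map_smul' := fun c x => by
        ext n
        cases n <;> simp [shiftCoord, mul_left_comm] }
    C (fun x => (shiftCoord_bound hC x).choose_spec)

open Classical in
/-- The unilateral weighted shift with respect to the orthonormal basis `e` and the weights `w`:
the bounded operator with `e n ↦ w n • e (n + 1)` for all `n`. Its value for an unbounded weight
sequence, for which no such bounded operator exists, is `0`. -/
def weightedShift (e : HilbertBasis ℕ ℂ H) (w : ℕ → ℝ) : H →L[ℂ] H :=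
  if h : ∃ C : ℝ, ∀ n, |w n| ≤ C then
    (e.repr.symm.toContinuousLinearEquiv : lp (fun _ : ℕ => ℂ) 2 →L[ℂ] H) ∘L
      shiftLp w h.choose h.choose_spec ∘L
      (e.repr.toContinuousLinearEquiv : H →L[ℂ] lp (fun _ : ℕ => ℂ) 2)
  else 0

theorem weightedShift_apply_basis (e : HilbertBasis ℕ ℂ H) {w : ℕ → ℝ}
    (h : ∃ C : ℝ, ∀ n, |w n| ≤ C) (n : ℕ) :
    weightedShift e w (e n) = (w n : ℂ) • e (n + 1) := by
  apply e.repr.injective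
  rw [map_smul, e.repr_self]
  ext k
  have hk : (e.repr (weightedShift e w (e n)) : ℕ → ℂ) k =
      shiftCoord w (lp.single 2 n (1 : ℂ) : lp (fun _ : ℕ => ℂ) 2) k := by
    rw [← e.repr_self n]
    simp [weightedShift, h, shiftLp]
  rw [hk]
  change _ = (w n : ℂ) * (lp.single 2 (n + 1) (1 : ℂ) : lp (fun _ : ℕ => ℂ) 2) k
  cases k with
  | zero => simp [shiftCoord]
  | succ k =>
    rcases eq_or_ne k n with rfl | hne
    · simp [shiftCoord]
    · simp [shiftCoord, hne]

/-! ### Trace-class operators and the weak* topology of `B(H)` -/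

/-- Trace-class operators on a Hilbert space: the operators `S = ∑ₙ ⟨·, yₙ⟩ xₙ` with
`∑ₙ ‖xₙ‖ ‖yₙ‖ < ∞` (Mathlib's inner product is conjugate-linear in the first variable). -/
def IsTraceClass (S : H →L[ℂ] H) : Prop :=
  ∃ x y : ℕ → H, Summable (fun n => ‖x n‖ * ‖y n‖) ∧
    ∀ v : H, HasSum (fun n => inner ℂ (y n) v • x n) (S v)

/-- The trace `∑ₙ ⟨S eₙ, eₙ⟩` of an operator, computed in the orthonormal basis `e`; for a
trace-class operator the series converges absolutely and does not depend on the basis. -/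
def trace (e : HilbertBasis ℕ ℂ H) (S : H →L[ℂ] H) : ℂ :=
  ∑' n, inner ℂ (e n) (S (e n))

/-- The weak* topology of `B(H)`, as the dual space of the trace-class operators under the pairing
`(A, S) ↦ tr (A S)`: the coarsest topology that makes all functionals `A ↦ tr (A S)`,
`S` of trace class, continuous. -/
@[reducible] def weakStarTopology (e : HilbertBasis ℕ ℂ H) : TopologicalSpace (H →L[ℂ] H) :=
  ⨅ S : {S : H →L[ℂ] H // IsTraceClass S},
    TopologicalSpace.induced (fun A => trace e (A ∘L S.1)) inferInstance

/-! ### Algebras generated by an operator -/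

/-- The algebra of all polynomials in `A`. -/
def polynomialsIn (A : H →L[ℂ] H) : Subalgebra ℂ (H →L[ℂ] H) :=
  (Polynomial.aeval (R := ℂ) A).range

/-- The Banach algebra generated by `A`: the norm closure of the polynomials in `A`. -/
def banachAlgebraGen (A : H →L[ℂ] H) : Subalgebra ℂ (H →L[ℂ] H) :=
  (polynomialsIn A).topologicalClosure

/-- The weakly closed algebra generated by `A`: the closure of the polynomials in `A` in the
weak operator topology. -/
def weaklyClosedAlgebraGen (A : H →L[ℂ] H) : Set (H →L[ℂ] H) :=
  {B | ContinuousLinearMapWOT.ofCLM B ∈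
    closure (ContinuousLinearMapWOT.ofCLM '' (polynomialsIn A : Set (H →L[ℂ] H)))}

/-- The dual algebra generated by `A`: the closure of the polynomials in `A` in the weak*
topology. -/
def dualAlgebraGen (e : HilbertBasis ℕ ℂ H) (A : H →L[ℂ] H) : Set (H →L[ℂ] H) :=
  @closure _ (weakStarTopology e) (polynomialsIn A : Set (H →L[ℂ] H))

/-- The commutant of `A`: all bounded operators that commute with `A`. -/
def commutant (A : H →L[ℂ] H) : Subalgebra ℂ (H →L[ℂ] H) :=
  Subalgebra.centralizer ℂ {A}

/-- The double commutant of `A`: all bounded operators that commute with the commutant of `A`. -/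
def doubleCommutant (A : H →L[ℂ] H) : Subalgebra ℂ (H →L[ℂ] H) :=
  Subalgebra.centralizer ℂ (commutant A : Set (H →L[ℂ] H))

end Operators

/-! ### The disk algebra and `H^∞` of the unit disk -/

/-- A function on a set `s` of complex numbers that contains the open unit disk is holomorphic in
that disk. -/
def HolomorphicInDisk {s : Set ℂ} (f : s → ℂ) : Prop :=
  ∃ g : ℂ → ℂ, DifferentiableOn ℂ g (Metric.ball 0 1) ∧
    ∀ z : s, (z : ℂ) ∈ Metric.ball (0 : ℂ) 1 → f z = g z

/-- The disk algebra: continuous functions on the closed unit disk that are holomorphic in the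
open disk, with the supremum norm. -/
def diskAlgebra : Subalgebra ℂ C(Metric.closedBall (0 : ℂ) 1, ℂ) where
  carrier := {f | HolomorphicInDisk f}
  mul_mem' := by
    rintro a b ⟨f, hf, hf'⟩ ⟨g, hg, hg'⟩
    exact ⟨f * g, hf.mul hg, fun z hz => by simp [hf' z hz, hg' z hz]⟩
  add_mem' := by
    rintro a b ⟨f, hf, hf'⟩ ⟨g, hg, hg'⟩
    exact ⟨f + g, hf.add hg, fun z hz => by simp [hf' z hz, hg' z hz]⟩
  algebraMap_mem' := fun c => ⟨fun _ => c, differentiableOn_const c, fun z _ => by simp⟩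

/-- The algebra `H^∞` of bounded holomorphic functions on the open unit disk, with the supremum
norm. -/
def hardyInfty : Subalgebra ℂ (Metric.ball (0 : ℂ) 1 →ᵇ ℂ) where
  carrier := {f | HolomorphicInDisk f}
  mul_mem' := by
    rintro a b ⟨f, hf, hf'⟩ ⟨g, hg, hg'⟩
    exact ⟨f * g, hf.mul hg, fun z hz => by simp [hf' z hz, hg' z hz]⟩
  add_mem' := by
    rintro a b ⟨f, hf, hf'⟩ ⟨g, hg, hg'⟩
    exact ⟨f + g, hf.add hg, fun z hz => by simp [hf' z hz, hg' z hz]⟩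
  algebraMap_mem' := fun c => ⟨fun _ => c, differentiableOn_const c, fun z _ => rfl⟩

end

end RandomShift

namespace RandomShift

/-! Write operators as matrices in the basis `e`. Call `a` the symbol of `B` when the entry of `B`
at `(m, n)` is `a (m - n)` times the product of the weights from `n` to `m - 1`, and zero above the
diagonal; formally, `B = ∑ aₖ Tᵏ`. The proof shows that the bounded operators with a symbol form an
isometric copy of `H^∞`, and that this copy is each of the algebras in (ii).

Randomness enters only through sure properties of almost every weight sequence: the weights lie in
`[0, 1]`, they have arbitrarily long runs arbitrarily close to `1` (second Borel–Cantelli lemma),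
and they never vanish if `X 0` has no atom at `0`. The rest is deterministic.

Upper bound `‖f(T)‖ ≤ ‖f‖`: the lower triangular Toeplitz matrices of `f` have norm at most `‖f‖`,
by Parseval. Inserting the weight products keeps this bound: the matrix is affine in each weight, so
the norm is largest when all weights are `±1`, and then the weights amount to multiplication by
diagonal unitaries on both sides (`ToeplitzBound.weighted`).

Lower bound: along a long run of weights near `1`, the matrix of `B` looks like the unweighted
Toeplitz matrix (`HasSymbol.norm_toeplitz_form_le`). Testing that matrix on geometric vectors, as
with Szegő kernels, gives `|∑ aₖ zᵏ| ≤ ‖B‖` in the disk (`HasSymbol.norm_tsum_le`). Thus the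
calculus is isometric, and every bounded operator with a symbol comes from `H^∞`.

Norm limits of polynomials in `T` then correspond to the disk algebra, the uniform closure of the
polynomials. Having a symbol is a system of linear equations in matrix entries, hence a closed
condition in both weak topologies; bounded polynomial approximation of `H^∞` functions gives
density. If no weight vanishes, commuting with `T` is a recursion on the entries whose solutions are
exactly the operators with a symbol; as these commute with each other, the commutant equals the
double commutant. -/

/-- The sequence `w` has arbitrarily long runs of consecutive entries that are arbitrarily close
to `1`. -/
def HasUnitRuns (w : ℕ → ℝ) : Prop :=
  ∀ (K : ℕ) (ε : ℝ), 0 < ε → ∃ N, ∀ j < K, 1 - ε < w (N + j)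

/-! ### Almost sure properties of the weights -/

section Probability

variable {Ω : Type*} [MeasurableSpace Ω] {P : Measure Ω}

/-- An event of positive probability for one term of an i.i.d. sequence almost surely occurs along
some block of `K` consecutive indices. -/
theorem ae_exists_run [IsProbabilityMeasure P] {X : ℕ → Ω → ℝ}
    (hmeas : ∀ n, Measurable (X n)) (hindep : iIndepFun X P)
    (hident : ∀ n, IdentDistrib (X n) (X 0) P P) {s : Set ℝ} (hs : MeasurableSet s)
    (hpos : P (X 0 ⁻¹' s) ≠ 0) (K : ℕ) :
    ∀ᵐ ω ∂P, ∃ N, ∀ j < K, X (N + j) ω ∈ s := by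
  rcases Nat.eq_zero_or_pos K with rfl | hK
  · exact Filter.Eventually.of_forall fun ω => ⟨0, fun j hj => absurd hj (Nat.not_lt_zero j)⟩
  have hprob : ∀ n, P (X n ⁻¹' s) = P (X 0 ⁻¹' s) := fun n => (hident n).measure_mem_eq hs
  set q := P (X 0 ⁻¹' s) with hq
  -- Cut the indices into disjoint blocks of length `K`, so that the block events `E i` below are
  -- independent.
  let g : ℕ × Fin K → ℕ := fun p => p.1 * K + p.2
  have hg : Function.Injective g := by
    rintro ⟨i, j⟩ ⟨i', j'⟩ h
    have h' : i * K + (j : ℕ) = i' * K + (j' : ℕ) := h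
    have hi : i = i' := by
      have := congrArg (· / K) h'
      simpa [Nat.add_div_of_dvd_right, Nat.mul_div_cancel, hK, Nat.div_eq_of_lt j.2,
        Nat.div_eq_of_lt j'.2] using this
    subst hi
    have : j = j' := by ext; omega
    rw [this]
  have hY : iIndepFun (fun p => X (g p)) P := hindep.precomp hg
  let E : ℕ → Set Ω := fun i => ⋂ j : Fin K, X (g (i, j)) ⁻¹' s
  have hEm : ∀ i, MeasurableSet (E i) := fun i => MeasurableSet.iInter fun j => hmeas _ hs
  have key : ∀ t : Finset ℕ, P (⋂ i ∈ t, E i) = ∏ i ∈ t, ∏ _j : Fin K, q := by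
    intro t
    have h1 : (⋂ i ∈ t, E i) = ⋂ p ∈ t ×ˢ (Finset.univ : Finset (Fin K)), X (g p) ⁻¹' s := by
      ext ω
      simp only [E, Set.mem_iInter, Finset.mem_product, Finset.mem_univ, and_true]
      exact ⟨fun h p hp => h p.1 hp p.2, fun h i hi j => h (i, j) hi⟩
    rw [h1, hY.meas_biInter (s := fun p => X (g p) ⁻¹' s) fun p _ => ⟨s, hs, rfl⟩,
      Finset.prod_product]
    simp [hprob]
  have hind : iIndepSet E P := by
    rw [iIndepSet_iff_meas_biInter hEm]
    intro t
    rw [key]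
    refine Finset.prod_congr rfl fun i _ => ?_
    simpa using (key {i}).symm
  -- Second Borel–Cantelli lemma: every block event has the same probability `q ^ K > 0`, so the
  -- probabilities have infinite sum.
  have hlim := measure_limsup_eq_one hEm hind (by
    have : ∀ i, P (E i) = q ^ K := fun i => by simpa using key {i}
    simp only [this]
    exact ENNReal.tsum_const_eq_top_of_ne_zero (pow_ne_zero _ hpos))
  have hae : ∀ᵐ ω ∂P, ω ∈ Filter.limsup E Filter.atTop :=
    (mem_ae_iff_prob_eq_one (MeasurableSet.measurableSet_limsup hEm)).2 hlim
  filter_upwards [hae] with ω hω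
  rw [Filter.mem_limsup_iff_frequently_mem] at hω
  obtain ⟨i, hi⟩ := hω.exists
  refine ⟨i * K, fun j hj => ?_⟩
  exact Set.mem_iInter.1 hi ⟨j, hj⟩

/-- Since `1` is in the support of the law, every neighbourhood of `1` has positive mass. It
suffices to treat the countably many pairs of a length and a tolerance `1 / (n + 1)`. -/
theorem ae_hasUnitRuns [IsProbabilityMeasure P] {X : ℕ → Ω → ℝ}
    (hmeas : ∀ n, Measurable (X n)) (hindep : iIndepFun X P)
    (hident : ∀ n, IdentDistrib (X n) (X 0) P P) (hR : 1 ∈ essRange (X 0) P) :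
    ∀ᵐ ω ∂P, HasUnitRuns fun n => X n ω := by
  have h : ∀ K n : ℕ, ∀ᵐ ω ∂P, ∃ N, ∀ j < K, X (N + j) ω ∈ Set.Ioi (1 - 1 / ((n : ℝ) + 1)) := by
    intro K n
    refine ae_exists_run hmeas hindep hident measurableSet_Ioi ?_ K
    rw [← Measure.map_apply (hmeas 0) measurableSet_Ioi]
    refine ((Measure.mem_support_iff_forall (1 : ℝ)).1 hR _ (Ioi_mem_nhds ?_)).ne'
    have : (0 : ℝ) < 1 / ((n : ℝ) + 1) := by positivity
    linarith
  filter_upwards [ae_all_iff.2 fun K => ae_all_iff.2 fun n => h K n] with ω hω K ε hε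
  obtain ⟨n, hn⟩ := exists_nat_one_div_lt hε
  obtain ⟨N, hN⟩ := hω K n
  refine ⟨N, fun j hj => ?_⟩
  have := hN j hj
  rw [Set.mem_Ioi] at this
  linarith

theorem ae_le_of_isGreatest_essRange {X : ℕ → Ω → ℝ} (hmeas : ∀ n, Measurable (X n))
    (hident : ∀ n, IdentDistrib (X n) (X 0) P P) {R : ℝ}
    (hR : IsGreatest (essRange (X 0) P) R) : ∀ᵐ ω ∂P, ∀ n, X n ω ≤ R := by
  rw [ae_all_iff]
  intro n
  have h0 : ∀ᵐ x ∂(P.map (X 0)), x ∈ Set.Iic R := by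
    filter_upwards [Measure.support_mem_ae (μ := P.map (X 0))] with x hx using hR.2 hx
  rw [← (hident n).map_eq] at h0
  exact ae_of_ae_map (hmeas n).aemeasurable h0

theorem ae_ne_of_measure_eq_zero {X : ℕ → Ω → ℝ}
    (hident : ∀ n, IdentDistrib (X n) (X 0) P P) {c : ℝ} (hc : P {ω | X 0 ω = c} = 0) :
    ∀ᵐ ω ∂P, ∀ n, X n ω ≠ c := by
  rw [ae_all_iff]
  intro n
  have h : P (X n ⁻¹' {c}) = P (X 0 ⁻¹' {c}) := (hident n).measure_mem_eq (measurableSet_singleton c)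
  have h0 : P (X n ⁻¹' {c}) = 0 := h.trans hc
  rw [ae_iff]
  simpa [Set.preimage] using h0

end Probability

/-! ### Norms of lower triangular Toeplitz matrices -/

section Toeplitz

open Polynomial in
/-- Parseval's identity for polynomials on the roots of unity. -/
theorem sum_norm_sq_eval_rootsOfUnity {N : ℕ} {ζ : ℂ} (hζ : IsPrimitiveRoot ζ N) (hN : N ≠ 0)
    (p : ℂ[X]) (hp : p.natDegree < N) :
    ∑ j ∈ Finset.range N, ‖p.eval (ζ ^ j)‖ ^ 2 = N * ∑ k ∈ Finset.range N, ‖p.coeff k‖ ^ 2 := by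
  have hnorm : ‖ζ‖ = 1 := hζ.norm'_eq_one hN
  have hζ0 : ζ ≠ 0 := hζ.ne_zero hN
  have hconj : (starRingEnd ℂ) ζ = ζ⁻¹ := by
    rw [Complex.inv_def, Complex.normSq_eq_norm_sq, hnorm]; simp
  have horth : ∀ k < N, ∀ l < N,
      ∑ j ∈ Finset.range N, (ζ ^ j) ^ k * (starRingEnd ℂ) ((ζ ^ j) ^ l) =
        if k = l then (N : ℂ) else 0 := by
    intro k hk l hl
    have h1 : ∀ j, (ζ ^ j) ^ k * (starRingEnd ℂ) ((ζ ^ j) ^ l) = (ζ ^ k * (ζ⁻¹) ^ l) ^ j := by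
      intro j
      rw [map_pow, map_pow, hconj, mul_pow]
      ring
    simp only [h1]
    split_ifs with hkl
    · subst hkl
      simp [hζ0]
    · have hne : ζ ^ k * (ζ⁻¹) ^ l ≠ 1 := by
        intro h
        apply hkl
        rw [inv_pow, mul_inv_eq_one₀ (pow_ne_zero _ hζ0)] at h
        exact hζ.pow_inj hk hl h
      have hpow : (ζ ^ k * (ζ⁻¹) ^ l) ^ N = 1 := by
        rw [mul_pow, ← pow_mul, ← pow_mul, mul_comm k, mul_comm l, pow_mul, pow_mul, inv_pow,
          hζ.pow_eq_one]
        simp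
      rw [geom_sum_eq hne, hpow]
      simp
  have hC : ((∑ j ∈ Finset.range N, ‖p.eval (ζ ^ j)‖ ^ 2 : ℝ) : ℂ) =
      ((N * ∑ k ∈ Finset.range N, ‖p.coeff k‖ ^ 2 : ℝ) : ℂ) := by
    push_cast
    calc ∑ j ∈ Finset.range N, (‖p.eval (ζ ^ j)‖ : ℂ) ^ 2
        = ∑ j ∈ Finset.range N, ∑ k ∈ Finset.range N, ∑ l ∈ Finset.range N,
            p.coeff k * (starRingEnd ℂ) (p.coeff l) *
              ((ζ ^ j) ^ k * (starRingEnd ℂ) ((ζ ^ j) ^ l)) := by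
          refine Finset.sum_congr rfl fun j _ => ?_
          rw [← Complex.mul_conj', eval_eq_sum_range' hp, map_sum, Finset.sum_mul_sum]
          refine Finset.sum_congr rfl fun k _ => Finset.sum_congr rfl fun l _ => ?_
          rw [map_mul]
          ring
      _ = ∑ k ∈ Finset.range N, ∑ l ∈ Finset.range N, p.coeff k * (starRingEnd ℂ) (p.coeff l) *
            ∑ j ∈ Finset.range N, ((ζ ^ j) ^ k * (starRingEnd ℂ) ((ζ ^ j) ^ l)) := by
          rw [Finset.sum_comm]
          refine Finset.sum_congr rfl fun k _ => ?_
          rw [Finset.sum_comm]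
          refine Finset.sum_congr rfl fun l _ => ?_
          rw [Finset.mul_sum]
      _ = ∑ k ∈ Finset.range N, N * (‖p.coeff k‖ : ℂ) ^ 2 := by
          refine Finset.sum_congr rfl fun k hk => ?_
          rw [Finset.sum_eq_single k]
          · rw [horth k (Finset.mem_range.1 hk) k (Finset.mem_range.1 hk), if_pos rfl,
              Complex.mul_conj']
            ring
          · intro l hl hne
            rw [horth k (Finset.mem_range.1 hk) l (Finset.mem_range.1 hl), if_neg hne.symm, mul_zero]
          · exact fun h => absurd hk h
      _ = _ := by rw [Finset.mul_sum]
  exact_mod_cast hC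

open Polynomial in
-- Multiplication by `p` is bounded pointwise by `C` on the circle. Parseval on the `N`-th roots of
-- unity carries this over to coefficients once `N` exceeds the degrees of `q` and `p * q`.
theorem sum_norm_sq_coeff_mul_le (p q : ℂ[X]) {C : ℝ}
    (hC : ∀ z : ℂ, ‖z‖ = 1 → ‖p.eval z‖ ≤ C) {M : ℕ} (hq : q.natDegree < M) :
    ∑ m ∈ Finset.range M, ‖(p * q).coeff m‖ ^ 2 ≤
      C ^ 2 * ∑ m ∈ Finset.range M, ‖q.coeff m‖ ^ 2 := by
  set N := p.natDegree + M with hNdef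
  have hN : N ≠ 0 := by omega
  have hζ := Complex.isPrimitiveRoot_exp N hN
  set ζ := Complex.exp (2 * Real.pi * Complex.I / N)
  have hpq : (p * q).natDegree < N := natDegree_mul_le.trans_lt (by omega)
  have h1 := sum_norm_sq_eval_rootsOfUnity hζ hN _ hpq
  have h2 := sum_norm_sq_eval_rootsOfUnity hζ hN q (by omega)
  have hNpos : (0 : ℝ) < N := by positivity
  have h3 : ∑ j ∈ Finset.range N, ‖(p * q).eval (ζ ^ j)‖ ^ 2 ≤
      C ^ 2 * ∑ j ∈ Finset.range N, ‖q.eval (ζ ^ j)‖ ^ 2 := by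
    rw [Finset.mul_sum]
    refine Finset.sum_le_sum fun j _ => ?_
    rw [eval_mul, norm_mul, mul_pow]
    gcongr
    apply hC
    rw [norm_pow, hζ.norm'_eq_one hN, one_pow]
  rw [h1, h2, mul_left_comm] at h3
  have h4 := le_of_mul_le_mul_left h3 hNpos
  have hsub : Finset.range M ⊆ Finset.range N := Finset.range_mono (by omega)
  calc ∑ m ∈ Finset.range M, ‖(p * q).coeff m‖ ^ 2
      ≤ ∑ m ∈ Finset.range N, ‖(p * q).coeff m‖ ^ 2 :=
        Finset.sum_le_sum_of_subset_of_nonneg hsub fun _ _ _ => by positivity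
    _ ≤ _ := h4
    _ = _ := by
        congr 1
        symm
        refine Finset.sum_subset hsub fun k _ hk => ?_
        rw [coeff_eq_zero_of_natDegree_lt (by simp at hk; omega)]
        simp

/-- The lower triangular Toeplitz matrices with symbol `a` have norm at most `C`. -/
def ToeplitzBound (a : ℕ → ℂ) (C : ℝ) : Prop :=
  ∀ (M : ℕ) (x : ℕ → ℂ),
    ∑ m ∈ Finset.range M, ‖∑ n ∈ Finset.range (m + 1), a (m - n) * x n‖ ^ 2 ≤
      C ^ 2 * ∑ m ∈ Finset.range M, ‖x m‖ ^ 2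

open Polynomial in
-- Applying the Toeplitz matrix to `x` computes the first `M` coefficients of `p * q`, where `q = ∑
-- xₙ zⁿ`.
theorem toeplitzBound_coeff (p : ℂ[X]) {C : ℝ} (hC : ∀ z : ℂ, ‖z‖ = 1 → ‖p.eval z‖ ≤ C) :
    ToeplitzBound p.coeff C := by
  intro M x
  rcases Nat.eq_zero_or_pos M with rfl | hM
  · simp
  set q : ℂ[X] := ∑ n ∈ Finset.range M, monomial n (x n) with hqdef
  have hcoeff : ∀ n < M, q.coeff n = x n := by
    intro n hn
    simp [hqdef, coeff_monomial, hn]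
  have hdeg : q.natDegree < M := by
    refine lt_of_le_of_lt (natDegree_sum_le_of_forall_le (n := M - 1) _ _ fun i hi => ?_) (by omega)
    exact (natDegree_monomial_le _).trans (by have := Finset.mem_range.1 hi; omega)
  have h := sum_norm_sq_coeff_mul_le p q hC hdeg
  have h2 : ∑ m ∈ Finset.range M, ‖q.coeff m‖ ^ 2 = ∑ m ∈ Finset.range M, ‖x m‖ ^ 2 :=
    Finset.sum_congr rfl fun m hm => by rw [hcoeff m (Finset.mem_range.1 hm)]
  rw [h2] at h
  refine le_of_eq_of_le (Finset.sum_congr rfl fun m hm => ?_) h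
  rw [mul_comm p q, coeff_mul, Finset.Nat.sum_antidiagonal_eq_sum_range_succ
    (f := fun i j => q.coeff i * p.coeff j)]
  refine congrArg (fun z : ℂ => ‖z‖ ^ 2) (Finset.sum_congr rfl fun n hn => ?_)
  rw [Finset.mem_range] at hm hn
  rw [hcoeff n (by omega), mul_comm]

/-- `a` is the sequence of Taylor coefficients at `0` of the function `f` on the unit disk. -/
def HasTaylorCoeffs (f : ℂ → ℂ) (a : ℕ → ℂ) : Prop :=
  ∀ z ∈ Metric.ball (0 : ℂ) 1, HasSum (fun k => a k * z ^ k) (f z)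

theorem HasTaylorCoeffs.summable_norm {f : ℂ → ℂ} {a : ℕ → ℂ} (h : HasTaylorCoeffs f a) {r : ℝ}
    (hr0 : 0 ≤ r) (hr1 : r < 1) : Summable fun k => ‖a k‖ * r ^ k := by
  have h1 := (h (r : ℂ) (by simpa [abs_of_nonneg hr0] using hr1)).summable.norm
  simpa [abs_of_nonneg hr0] using h1

open Polynomial in
/-- The truncated Taylor polynomial of the dilation `z ↦ f (r z)`. -/
noncomputable def dilatedTaylor (a : ℕ → ℂ) (r : ℝ) (K : ℕ) : ℂ[X] :=
  ∑ k ∈ Finset.range K, monomial k (a k * (r : ℂ) ^ k)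

theorem coeff_dilatedTaylor (a : ℕ → ℂ) (r : ℝ) (K k : ℕ) :
    (dilatedTaylor a r K).coeff k = if k < K then a k * (r : ℂ) ^ k else 0 := by
  simp [dilatedTaylor, Polynomial.coeff_monomial]

theorem HasTaylorCoeffs.exists_norm_eval_dilatedTaylor_sub_le {f : ℂ → ℂ} {a : ℕ → ℂ}
    (h : HasTaylorCoeffs f a) {r : ℝ} (hr0 : 0 ≤ r) (hr1 : r < 1) {ε : ℝ} (hε : 0 < ε) :
    ∃ K₀, ∀ K ≥ K₀, ∀ z : ℂ, ‖z‖ ≤ 1 → ‖(dilatedTaylor a r K).eval z - f (r * z)‖ ≤ ε := by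
  have hs := h.summable_norm hr0 hr1
  have ht := tendsto_sum_nat_add fun k => ‖a k‖ * r ^ k
  obtain ⟨K₀, hK₀⟩ := Filter.eventually_atTop.1 (ht.eventually (gt_mem_nhds hε))
  refine ⟨K₀, fun K hK z hz => ?_⟩
  have hz' : (r : ℂ) * z ∈ Metric.ball (0 : ℂ) 1 := by
    simp only [mem_ball_zero_iff, norm_mul, Complex.norm_real, Real.norm_eq_abs,
      abs_of_nonneg hr0]
    nlinarith [norm_nonneg z]
  have h1 := h _ hz'
  have h2 : (dilatedTaylor a r K).eval z = ∑ k ∈ Finset.range K, a k * (r * z) ^ k := by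
    simp only [dilatedTaylor, Polynomial.eval_finsetSum, Polynomial.eval_monomial, mul_pow]
    exact Finset.sum_congr rfl fun k _ => by ring
  have hle : ∀ k, ‖a k * ((r : ℂ) * z) ^ k‖ ≤ ‖a k‖ * r ^ k := by
    intro k
    rw [norm_mul, norm_pow, norm_mul, Complex.norm_real, Real.norm_eq_abs, abs_of_nonneg hr0]
    gcongr
    exact mul_le_of_le_one_right hr0 hz
  rw [h2, ← h1.tsum_eq, ← h1.summable.sum_add_tsum_nat_add K, sub_add_cancel_left, norm_neg]
  refine (tsum_of_norm_bounded ((summable_nat_add_iff K).2 hs).hasSum fun k => hle _).trans ?_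
  exact (hK₀ K hK).le

/-- Dilation by `r < 1` reduces the claim to polynomials, up to an error `ε`. For fixed `M` only
finitely many coefficients occur, so one may let `ε → 0` and then `r → 1`. -/
theorem HasTaylorCoeffs.toeplitzBound {f : ℂ → ℂ} {a : ℕ → ℂ} (h : HasTaylorCoeffs f a) {C : ℝ}
    (hC : ∀ z ∈ Metric.ball (0 : ℂ) 1, ‖f z‖ ≤ C) : ToeplitzBound a C := by
  intro M x
  have hstep : ∀ r : ℝ, 0 ≤ r → r < 1 → ∀ ε : ℝ, 0 < ε →
      ∑ m ∈ Finset.range M, ‖∑ n ∈ Finset.range (m + 1), a (m - n) * (r : ℂ) ^ (m - n) * x n‖ ^ 2 ≤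
        (C + ε) ^ 2 * ∑ m ∈ Finset.range M, ‖x m‖ ^ 2 := by
    intro r hr0 hr1 ε hε
    obtain ⟨K₀, hK₀⟩ := h.exists_norm_eval_dilatedTaylor_sub_le hr0 hr1 hε
    -- Degree at least `K₀` gives the bound `C + ε`; degree at least `M` leaves the coefficients
    -- seen by the first `M` rows untruncated.
    have hb := toeplitzBound_coeff (dilatedTaylor a r (max K₀ M)) (C := C + ε) (fun z hz => by
      have h1 := hK₀ _ (le_max_left K₀ M) z hz.le
      have h2 := hC (r * z) (by simpa [hz, abs_of_nonneg hr0] using hr1)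
      calc _ = ‖f (r * z) + ((dilatedTaylor a r (max K₀ M)).eval z - f (r * z))‖ := by
            rw [add_sub_cancel]
        _ ≤ _ := (norm_add_le _ _).trans (add_le_add h2 h1)) M x
    refine le_of_eq_of_le (Finset.sum_congr rfl fun m hm => ?_) hb
    congr 2
    refine Finset.sum_congr rfl fun n _ => ?_
    rw [coeff_dilatedTaylor, if_pos]
    have := Finset.mem_range.1 hm
    omega
  have hstep' : ∀ r : ℝ, 0 ≤ r → r < 1 →
      ∑ m ∈ Finset.range M, ‖∑ n ∈ Finset.range (m + 1), a (m - n) * (r : ℂ) ^ (m - n) * x n‖ ^ 2 ≤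
        C ^ 2 * ∑ m ∈ Finset.range M, ‖x m‖ ^ 2 := by
    intro r hr0 hr1
    have hcont : Continuous fun ε : ℝ => (C + ε) ^ 2 * ∑ m ∈ Finset.range M, ‖x m‖ ^ 2 := by
      fun_prop
    have ht := (hcont.tendsto 0).mono_left (nhdsWithin_le_nhds (s := Set.Ioi 0))
    rw [add_zero] at ht
    exact ge_of_tendsto ht (Filter.eventually_of_mem self_mem_nhdsWithin
      fun ε hε => hstep r hr0 hr1 ε hε)
  have hcont : Continuous fun r : ℝ => ∑ m ∈ Finset.range M,
      ‖∑ n ∈ Finset.range (m + 1), a (m - n) * (r : ℂ) ^ (m - n) * x n‖ ^ 2 := by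
    fun_prop
  have ht := (hcont.tendsto 1).mono_left (nhdsWithin_le_nhds (s := Set.Iio 1))
  simp only [Complex.ofReal_one, one_pow, mul_one] at ht
  refine le_of_tendsto ht ?_
  filter_upwards [Ioo_mem_nhdsLT (zero_lt_one' ℝ)] with r hr using hstep' r hr.1.le hr.2

end Toeplitz

/-! ### Schur multiplication by weight products -/

section Schur

/-- A function of the variables `w j` that is affine in each of the variables with indices in `s`
attains its bounds over the cube `[-1, 1]^s` at the vertices. -/
theorem norm_le_of_affine_on_cube {E : Type*} [NormedAddCommGroup E] [NormedSpace ℝ E]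
    (F : (ℕ → ℝ) → E) {C : ℝ}
    (haff : ∀ w j, F w = ((1 + w j) / 2) • F (Function.update w j 1) +
      ((1 - w j) / 2) • F (Function.update w j (-1)))
    (hvert : ∀ w : ℕ → ℝ, (∀ j, w j = 1 ∨ w j = -1) → ‖F w‖ ≤ C) (s : Finset ℕ) :
    ∀ w : ℕ → ℝ, (∀ j, |w j| ≤ 1) → (∀ j ∉ s, w j = 1 ∨ w j = -1) → ‖F w‖ ≤ C := by
  induction s using Finset.induction_on with
  | empty => exact fun w _ h => hvert w fun j => h j (Finset.notMem_empty j)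
  | insert k s _ ih =>
    intro w hw hws
    have hup : ∀ c : ℝ, c = 1 ∨ c = -1 → ‖F (Function.update w k c)‖ ≤ C := by
      intro c hc
      refine ih _ (fun j => ?_) fun j hj => ?_
      · rcases eq_or_ne j k with rfl | hjk
        · rcases hc with rfl | rfl <;> simp
        · simpa [hjk] using hw j
      · rcases eq_or_ne j k with rfl | hjk
        · simpa using hc
        · simpa [hjk] using hws j (by simp [hjk, hj])
    have h1 := (abs_le.1 (hw k)).1
    have h2 := (abs_le.1 (hw k)).2
    have h3 := hup 1 (Or.inl rfl)
    have h4 := hup (-1) (Or.inr rfl)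
    rw [haff w k]
    calc _ ≤ ((1 + w k) / 2) * C + ((1 - w k) / 2) * C := by
          refine (norm_add_le _ _).trans (add_le_add ?_ ?_)
          · rw [norm_smul, Real.norm_of_nonneg (by linarith)]
            exact mul_le_mul_of_nonneg_left h3 (by linarith)
          · rw [norm_smul, Real.norm_of_nonneg (by linarith)]
            exact mul_le_mul_of_nonneg_left h4 (by linarith)
      _ = C := by ring

/-- The product of the weights from position `n` to position `m`. -/
noncomputable def weightProd (w : ℕ → ℝ) (n m : ℕ) : ℂ := ∏ j ∈ Finset.Ico n m, (w j : ℂ)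

@[simp] theorem weightProd_self (w : ℕ → ℝ) (n : ℕ) : weightProd w n n = 1 := by
  simp [weightProd]

theorem weightProd_succ (w : ℕ → ℝ) {n m : ℕ} (h : n ≤ m) :
    weightProd w n (m + 1) = weightProd w n m * w m :=
  Finset.prod_Ico_succ_top h _

theorem weightProd_mul (w : ℕ → ℝ) {l n m : ℕ} (h : l ≤ n) (h' : n ≤ m) :
    weightProd w l n * weightProd w n m = weightProd w l m :=
  Finset.prod_Ico_consecutive _ h h'

theorem weightProd_ne_zero {w : ℕ → ℝ} (hw : ∀ j, w j ≠ 0) (n m : ℕ) : weightProd w n m ≠ 0 :=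
  Finset.prod_ne_zero_iff.2 fun j _ => by exact_mod_cast hw j

theorem weightProd_congr {w v : ℕ → ℝ} {n m : ℕ} (h : ∀ j, n ≤ j → j < m → w j = v j) :
    weightProd w n m = weightProd v n m :=
  Finset.prod_congr rfl fun j hj => by
    rw [Finset.mem_Ico] at hj
    rw [h j hj.1 hj.2]

theorem weightProd_affine (w : ℕ → ℝ) (j n m : ℕ) :
    weightProd w n m = (((1 + w j) / 2 : ℝ) : ℂ) * weightProd (Function.update w j 1) n m +
      (((1 - w j) / 2 : ℝ) : ℂ) * weightProd (Function.update w j (-1)) n m := by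
  by_cases hj : j ∈ Finset.Ico n m
  · have h : ∀ c : ℝ, weightProd (Function.update w j c) n m =
        c * ∏ i ∈ (Finset.Ico n m).erase j, (w i : ℂ) := by
      intro c
      rw [weightProd, ← Finset.mul_prod_erase _ _ hj, Function.update_self]
      congr 1
      exact Finset.prod_congr rfl fun i hi => by
        rw [Function.update_of_ne (Finset.ne_of_mem_erase hi)]
    rw [h, h, weightProd, ← Finset.mul_prod_erase _ _ hj]
    push_cast
    ring
  · have h : ∀ c : ℝ, weightProd (Function.update w j c) n m = weightProd w n m := by
      intro c
      refine weightProd_congr fun i h1 h2 => Function.update_of_ne ?_ _ _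
      rintro rfl
      exact hj (Finset.mem_Ico.2 ⟨h1, h2⟩)
    rw [h, h]
    push_cast
    ring

/-- Schur multiplication by the products of weights of modulus at most `1` does not increase the
norm of lower triangular Toeplitz matrices. -/
theorem ToeplitzBound.weighted {a : ℕ → ℂ} {C : ℝ} (h : ToeplitzBound a C) (hC : 0 ≤ C)
    {w : ℕ → ℝ} (hw : ∀ j, |w j| ≤ 1) (M : ℕ) (x : ℕ → ℂ) :
    ∑ m ∈ Finset.range M,
        ‖∑ n ∈ Finset.range (m + 1), a (m - n) * weightProd w n m * x n‖ ^ 2 ≤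
      C ^ 2 * ∑ m ∈ Finset.range M, ‖x m‖ ^ 2 := by
  let F : (ℕ → ℝ) → EuclideanSpace ℂ (Fin M) := fun w =>
    WithLp.toLp 2 fun m => ∑ n ∈ Finset.range ((m : ℕ) + 1), a (m - n) * weightProd w n m * x n
  have hF : ∀ w, ‖F w‖ ^ 2 = ∑ m ∈ Finset.range M,
      ‖∑ n ∈ Finset.range (m + 1), a (m - n) * weightProd w n m * x n‖ ^ 2 := by
    intro w
    rw [EuclideanSpace.norm_sq_eq]
    exact Fin.sum_univ_eq_sum_range (fun m : ℕ =>
      ‖∑ n ∈ Finset.range (m + 1), a (m - n) * weightProd w n m * x n‖ ^ 2) M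
  set S := Real.sqrt (∑ m ∈ Finset.range M, ‖x m‖ ^ 2) with hS
  have hS2 : S ^ 2 = ∑ m ∈ Finset.range M, ‖x m‖ ^ 2 :=
    Real.sq_sqrt (Finset.sum_nonneg fun _ _ => by positivity)
  -- For signs, the product from `n` to `m` equals `d m * d n` with `d = weightProd w 0` unimodular,
  -- so the weighted matrix is `D A D` with `D` a diagonal unitary.
  have hvert : ∀ w : ℕ → ℝ, (∀ j, w j = 1 ∨ w j = -1) → ‖F w‖ ≤ C * S := by
    intro w hw
    have hsq : ∀ j, (w j : ℂ) * w j = 1 := by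
      intro j
      rcases hw j with h | h <;> simp [h]
    have hd1 : ∀ m, weightProd w 0 m * weightProd w 0 m = 1 := by
      intro m
      rw [weightProd, ← Finset.prod_mul_distrib]
      exact Finset.prod_eq_one fun j _ => hsq j
    have hn1 : ∀ m, ‖weightProd w 0 m‖ = 1 := by
      intro m
      have := congrArg norm (hd1 m)
      rw [norm_mul, norm_one] at this
      nlinarith [norm_nonneg (weightProd w 0 m)]
    have hsplit : ∀ n m, n ≤ m → weightProd w n m = weightProd w 0 m * weightProd w 0 n := by
      intro n m hnm
      rw [← weightProd_mul w (Nat.zero_le n) hnm]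
      linear_combination (-weightProd w n m) * hd1 n
    refine abs_le_of_sq_le_sq' ?_ (by positivity) |>.2
    rw [hF, mul_pow, hS2]
    have h1 := h M fun n => weightProd w 0 n * x n
    simp only [norm_mul (weightProd w 0 _), hn1, one_mul] at h1
    refine le_of_eq_of_le (Finset.sum_congr rfl fun m hm => ?_) h1
    have : ∑ n ∈ Finset.range (m + 1), a (m - n) * weightProd w n m * x n =
        weightProd w 0 m * ∑ n ∈ Finset.range (m + 1), a (m - n) * (weightProd w 0 n * x n) := by
      rw [Finset.mul_sum]
      refine Finset.sum_congr rfl fun n hn => ?_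
      rw [hsplit n m (Nat.lt_succ_iff.1 (Finset.mem_range.1 hn))]
      ring
    rw [this, norm_mul, hn1, one_mul]
  have haff : ∀ w j, F w = ((1 + w j) / 2) • F (Function.update w j 1) +
      ((1 - w j) / 2) • F (Function.update w j (-1)) := by
    intro w j
    ext m
    simp only [F, PiLp.add_apply, PiLp.smul_apply, Complex.real_smul, Finset.mul_sum]
    rw [← Finset.sum_add_distrib]
    refine Finset.sum_congr rfl fun n _ => ?_
    conv_lhs => rw [weightProd_affine w j n m]
    ring
  -- The cube lemma moves only finitely many coordinates. Weights with index at least `M` do not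
  -- affect the section and may be reset to the vertex value `1`.
  set v : ℕ → ℝ := fun j => if j < M then w j else 1 with hv
  have hFv : F w = F v := by
    ext m
    simp only [F]
    refine Finset.sum_congr rfl fun n _ => ?_
    rw [weightProd_congr (w := w) (v := v) fun j _ hj => by simp [hv, hj.trans m.2]]
  have hmain : ‖F v‖ ≤ C * S := by
    refine norm_le_of_affine_on_cube F haff hvert (Finset.range M) v (fun j => ?_) fun j hj => ?_
    · by_cases hj : j < M <;> simp [hv, hj, hw j]
    · left
      simp only [Finset.mem_range] at hj
      simp [hv, hj]
  rw [← hF, ← hS2, ← mul_pow, hFv]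
  gcongr

end Schur

/-! ### Operators with a symbol -/

section Symbol

variable {H : Type*} [NormedAddCommGroup H] [InnerProductSpace ℂ H]

/-- In the basis `e`, the operator `B` has the matrix of the formal power series `∑ aₖ Tᵏ` in the
weighted shift `T` with weights `w`. -/
def HasSymbol (e : HilbertBasis ℕ ℂ H) (w : ℕ → ℝ) (B : H →L[ℂ] H) (a : ℕ → ℂ) : Prop :=
  ∀ m n, inner ℂ (e m) (B (e n)) = if n ≤ m then a (m - n) * weightProd w n m else 0

variable {e : HilbertBasis ℕ ℂ H} {w : ℕ → ℝ}

theorem ext_inner_basis {x y : H} (h : ∀ m, inner ℂ (e m) x = inner ℂ (e m) y) : x = y := by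
  apply e.repr.injective
  ext m
  rw [e.repr_apply_apply, e.repr_apply_apply, h]

theorem hasSum_inner_smul (x : H) : HasSum (fun n => inner ℂ (e n) x • e n) x := by
  simpa only [e.repr_apply_apply] using e.hasSum_repr x

theorem hasSum_apply (B : H →L[ℂ] H) (x : H) :
    HasSum (fun n => inner ℂ (e n) x • B (e n)) (B x) := by
  simpa using (hasSum_inner_smul (e := e) x).mapL B

theorem clm_ext_basis {A B : H →L[ℂ] H} (h : ∀ n, A (e n) = B (e n)) : A = B := by
  ext x
  have hA := hasSum_apply (e := e) A x
  simp only [h] at hA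
  exact hA.unique (hasSum_apply B x)

theorem HasSymbol.unique {A B : H →L[ℂ] H} {a : ℕ → ℂ} (hA : HasSymbol e w A a)
    (hB : HasSymbol e w B a) : A = B :=
  clm_ext_basis (e := e) fun n => ext_inner_basis (e := e) fun m => by rw [hA, hB]

theorem HasSymbol.add {A B : H →L[ℂ] H} {a b : ℕ → ℂ} (hA : HasSymbol e w A a)
    (hB : HasSymbol e w B b) : HasSymbol e w (A + B) (a + b) := by
  intro m n
  rw [_root_.add_apply, inner_add_right, hA, hB]
  split_ifs <;> simp [add_mul]

theorem HasSymbol.algebraMap (c : ℂ) :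
    HasSymbol e w (algebraMap ℂ (H →L[ℂ] H) c) (fun k => if k = 0 then c else 0) := by
  intro m n
  rw [Algebra.algebraMap_eq_smul_one, _root_.smul_apply,
    one_apply_eq_self, inner_smul_right, orthonormal_iff_ite.1 e.orthonormal]
  rcases lt_trichotomy m n with h | h | h
  · simp [h.ne, not_le.2 h]
  · simp [h]
  · simp [h.ne', h.le, Nat.sub_ne_zero_of_lt h]

/-- Weight products over consecutive intervals multiply, so the matrix product reduces to the Cauchy
product of the symbols. -/
theorem HasSymbol.mul {A B : H →L[ℂ] H} {a b : ℕ → ℂ} (hA : HasSymbol e w A a)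
    (hB : HasSymbol e w B b) :
    HasSymbol e w (A * B) (fun k => ∑ p ∈ Finset.HasAntidiagonal.antidiagonal k, a p.1 * b p.2) := by
  intro m l
  have h1 : HasSum (fun n => inner ℂ (e n) (B (e l)) * inner ℂ (e m) (A (e n)))
      (inner ℂ (e m) (A (B (e l)))) := by
    simpa [inner_smul_right] using (hasSum_apply (e := e) A (B (e l))).mapL (innerSL ℂ (e m))
  rw [mul_apply_eq_comp, ← h1.tsum_eq]
  rw [tsum_eq_sum (s := Finset.Ico l (m + 1)) fun n hn => by
    rw [hA, hB]
    rw [Finset.mem_Ico] at hn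
    by_cases hl : l ≤ n
    · rw [if_neg (c := n ≤ m) (by omega), mul_zero]
    · rw [if_neg hl, zero_mul]]
  split_ifs with hlm
  · rw [Finset.sum_mul, Finset.Nat.sum_antidiagonal_eq_sum_range_succ_mk,
      ← Finset.sum_range_reflect, Finset.sum_Ico_eq_sum_range]
    have hs : m + 1 - l = m - l + 1 := by omega
    rw [hs]
    refine Finset.sum_congr rfl fun i hi => ?_
    rw [Finset.mem_range] at hi
    rw [hA, hB, if_pos (by omega), if_pos (by omega),
      ← weightProd_mul w (l := l) (n := l + i) (m := m) (by omega) (by omega)]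
    have e1 : l + i - l = i := by omega
    have e2 : m - l - (m - (l + i)) = i := by omega
    have e3 : m - l + 1 - 1 - i = m - (l + i) := by omega
    simp only [e1, e3, e2]
    ring
  · rw [Finset.Ico_eq_empty (by omega), Finset.sum_empty]

theorem hasSymbol_weightedShift (h : ∃ C : ℝ, ∀ n, |w n| ≤ C) :
    HasSymbol e w (weightedShift e w) (fun k => if k = 1 then 1 else 0) := by
  intro m n
  rw [weightedShift_apply_basis e h, inner_smul_right, orthonormal_iff_ite.1 e.orthonormal]
  by_cases hm : m = n + 1
  · subst hm
    simp [weightProd]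
  · rw [if_neg hm, mul_zero]
    split_ifs with h1
    · have h2 : m - n ≠ 1 := by omega
      simp [h2]
    · rfl

/-- The bound on finite sections is uniform in `M`, so the infinite matrix maps square-summable
coordinates to square-summable ones with norm at most `C`. -/
theorem exists_hasSymbol {a : ℕ → ℂ} {C : ℝ} (ha : ToeplitzBound a C) (hC : 0 ≤ C)
    (hw : ∀ j, |w j| ≤ 1) : ∃ B : H →L[ℂ] H, ‖B‖ ≤ C ∧ HasSymbol e w B a := by
  let y : (ℕ → ℂ) → ℕ → ℂ := fun x m =>
    ∑ n ∈ Finset.range (m + 1), a (m - n) * weightProd w n m * x n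
  have hbd : ∀ (x : H) (M : ℕ), ∑ m ∈ Finset.range M,
      ‖y (fun n => inner ℂ (e n) x) m‖ ^ 2 ≤ C ^ 2 * ‖x‖ ^ 2 := by
    intro x M
    refine (ha.weighted hC hw M _).trans ?_
    gcongr
    exact e.orthonormal.sum_inner_products_le x
  have h2 : (0 : ℝ) < (2 : ENNReal).toReal := by norm_num
  have hmem : ∀ x : H, Memℓp (y fun n => inner ℂ (e n) x) 2 := by
    intro x
    refine memℓp_gen ?_
    simp only [ENNReal.toReal_ofNat, Real.rpow_ofNat]
    exact summable_of_sum_range_le (fun _ => by positivity) (hbd x)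
  let L : H →L[ℂ] lp (fun _ : ℕ => ℂ) 2 := LinearMap.mkContinuous
    { toFun := fun x => ⟨y fun n => inner ℂ (e n) x, hmem x⟩
      map_add' := fun u v => by
        ext m
        simp only [y, lp.coeFn_add, Pi.add_apply, ← Finset.sum_add_distrib, inner_add_right,
          mul_add]
      map_smul' := fun c v => by
        ext m
        simp only [y, lp.coeFn_smul, Pi.smul_apply, smul_eq_mul, Finset.mul_sum, inner_smul_right,
          RingHom.id_apply]
        exact Finset.sum_congr rfl fun n _ => by ring }
    C (fun x => by
      refine lp.norm_le_of_tsum_le h2 (by positivity) ?_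
      simp only [ENNReal.toReal_ofNat, Real.rpow_ofNat, LinearMap.coe_mk, AddHom.coe_mk, mul_pow]
      exact Real.tsum_le_of_sum_range_le (fun _ => by positivity) (hbd x))
  have hL : ‖L‖ ≤ C := LinearMap.mkContinuous_norm_le _ hC _
  refine ⟨(e.repr.symm.toContinuousLinearEquiv : lp (fun _ : ℕ => ℂ) 2 →L[ℂ] H) ∘L L, ?_, ?_⟩
  · refine ContinuousLinearMap.opNorm_le_bound _ hC fun x => ?_
    have : ‖((e.repr.symm.toContinuousLinearEquiv : lp (fun _ : ℕ => ℂ) 2 →L[ℂ] H) ∘L L) x‖ =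
        ‖L x‖ := e.repr.symm.norm_map (L x)
    rw [this]
    exact (L.le_opNorm x).trans (by gcongr)
  · intro m n
    have h1 : inner ℂ (e m) (((e.repr.symm.toContinuousLinearEquiv :
        lp (fun _ : ℕ => ℂ) 2 →L[ℂ] H) ∘L L) (e n)) = (L (e n) : ℕ → ℂ) m := by
      rw [← e.repr_apply_apply]
      simp
    rw [h1]
    change ∑ i ∈ Finset.range (m + 1), a (m - i) * weightProd w i m * inner ℂ (e i) (e n) = _
    simp only [orthonormal_iff_ite.1 e.orthonormal, mul_ite, mul_one, mul_zero,
      Finset.sum_ite_eq', Finset.mem_range, Nat.lt_succ_iff]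

end Symbol

/-! ### Lower bound for the norm through runs of weights near one -/

section LowerBound

variable {H : Type*} [NormedAddCommGroup H] [InnerProductSpace ℂ H]
  {e : HilbertBasis ℕ ℂ H} {w : ℕ → ℝ}

theorem norm_sum_smul_basis (e : HilbertBasis ℕ ℂ H) (N K : ℕ) (α : ℕ → ℂ) :
    ‖∑ n ∈ Finset.range K, α n • e (N + n)‖ = Real.sqrt (∑ n ∈ Finset.range K, ‖α n‖ ^ 2) := by
  have ho : Orthonormal ℂ fun n => e (N + n) :=
    e.orthonormal.comp _ (add_right_injective N)
  rw [← Real.sqrt_sq (norm_nonneg _)]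
  congr 1
  have h := ho.inner_sum α α (Finset.range K)
  rw [inner_self_eq_norm_sq_to_K] at h
  have h' : ((‖∑ n ∈ Finset.range K, α n • e (N + n)‖ ^ 2 : ℝ) : ℂ) =
      ((∑ n ∈ Finset.range K, ‖α n‖ ^ 2 : ℝ) : ℂ) := by
    push_cast
    refine h.trans (Finset.sum_congr rfl fun n _ => ?_)
    rw [Complex.conj_mul']
  exact_mod_cast h'

/-- The finite Toeplitz sections of the symbol of `B` are bounded by the norm of `B`: along long
runs of weights close to `1`, the matrix of `B` is close to these sections. -/
theorem HasSymbol.norm_toeplitz_form_le {B : H →L[ℂ] H} {a : ℕ → ℂ} (h : HasSymbol e w B a)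
    (hw1 : ∀ n, w n ≤ 1) (hruns : HasUnitRuns w) (K : ℕ) (α β : ℕ → ℂ) :
    ‖∑ n ∈ Finset.range K, ∑ m ∈ Finset.range K,
        if n ≤ m then β m * a (m - n) * α n else 0‖ ≤
      ‖B‖ * Real.sqrt (∑ n ∈ Finset.range K, ‖α n‖ ^ 2) *
        Real.sqrt (∑ n ∈ Finset.range K, ‖β n‖ ^ 2) := by
  choose N hN using fun i : ℕ => hruns K (1 / ((i : ℝ) + 1)) (by positivity)
  have hwt : ∀ j < K, Filter.Tendsto (fun i => w (N i + j)) Filter.atTop (nhds 1) := by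
    intro j hj
    have h0 : Filter.Tendsto (fun i : ℕ => 1 - 1 / ((i : ℝ) + 1)) Filter.atTop (nhds 1) := by
      simpa using tendsto_const_nhds.sub (tendsto_one_div_add_atTop_nhds_zero_nat (𝕜 := ℝ))
    exact tendsto_of_tendsto_of_tendsto_of_le_of_le h0 tendsto_const_nhds
      (fun i => (hN i j hj).le) fun i => hw1 _
  have hW : ∀ n m, m < K → Filter.Tendsto (fun i => weightProd w (N i + n) (N i + m))
      Filter.atTop (nhds 1) := by
    intro n m hm
    have heq : ∀ i, weightProd w (N i + n) (N i + m) =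
        ∏ j ∈ Finset.Ico n m, ((w (N i + j) : ℝ) : ℂ) := fun i => by
      rw [Finset.prod_Ico_add (fun j => ((w j : ℝ) : ℂ)), weightProd, add_comm n, add_comm m]
    simp only [heq]
    have h1 := tendsto_finsetProd (Finset.Ico n m) (f := fun j i => ((w (N i + j) : ℝ) : ℂ))
      (a := fun _ => 1) (x := Filter.atTop) fun j hj => by
        have := (Complex.continuous_ofReal.tendsto 1).comp
          (hwt j ((Finset.mem_Ico.1 hj).2.trans hm))
        rwa [Complex.ofReal_one] at this
    simpa using h1
  have hlim : Filter.Tendsto (fun i => ‖∑ n ∈ Finset.range K, ∑ m ∈ Finset.range K,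
      if n ≤ m then β m * (a (m - n) * weightProd w (N i + n) (N i + m)) * α n else 0‖)
      Filter.atTop (nhds ‖∑ n ∈ Finset.range K, ∑ m ∈ Finset.range K,
        if n ≤ m then β m * a (m - n) * α n else 0‖) := by
    refine (tendsto_finsetSum _ fun n _ => tendsto_finsetSum _ fun m hm => ?_).norm
    split_ifs
    · have := ((hW n m (Finset.mem_range.1 hm)).const_mul (a (m - n))).const_mul (β m)
        |>.mul_const (α n)
      simpa using this
    · exact tendsto_const_nhds
  refine le_of_tendsto hlim (Filter.Eventually.of_forall fun i => ?_)
  set x := ∑ n ∈ Finset.range K, α n • e (N i + n) with hx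
  -- The conjugates compensate for the conjugate-linearity of the inner product in its first
  -- variable.
  set y := ∑ n ∈ Finset.range K, (starRingEnd ℂ) (β n) • e (N i + n) with hy
  have hform : ∑ n ∈ Finset.range K, ∑ m ∈ Finset.range K,
      (if n ≤ m then β m * (a (m - n) * weightProd w (N i + n) (N i + m)) * α n else 0) =
      inner ℂ y (B x) := by
    rw [hx, hy, map_sum, inner_sum]
    refine Finset.sum_congr rfl fun n _ => ?_
    rw [sum_inner]
    refine Finset.sum_congr rfl fun m _ => ?_
    rw [map_smul, inner_smul_left, inner_smul_right, h, RingHomCompTriple.comp_apply,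
      RingHom.id_apply]
    simp only [add_le_add_iff_left, Nat.add_sub_add_left]
    split_ifs
    · ring
    · simp
  have hyn : ‖y‖ = Real.sqrt (∑ n ∈ Finset.range K, ‖β n‖ ^ 2) := by
    rw [hy, norm_sum_smul_basis]
    simp
  rw [hform, ← hyn, ← norm_sum_smul_basis e (N i) K α, ← hx]
  calc ‖inner ℂ y (B x)‖ ≤ ‖y‖ * ‖B x‖ := norm_inner_le_norm _ _
    _ ≤ ‖y‖ * (‖B‖ * ‖x‖) := by gcongr; exact B.le_opNorm x
    _ = _ := by ring

theorem HasSymbol.norm_coeff_le {B : H →L[ℂ] H} {a : ℕ → ℂ} (h : HasSymbol e w B a)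
    (hw1 : ∀ n, w n ≤ 1) (hruns : HasUnitRuns w) (k : ℕ) : ‖a k‖ ≤ ‖B‖ := by
  have h1 := h.norm_toeplitz_form_le hw1 hruns (k + 1) (fun n => if n = 0 then 1 else 0)
    (fun n => if n = k then 1 else 0)
  have h2 : ∑ n ∈ Finset.range (k + 1), ∑ m ∈ Finset.range (k + 1),
      (if n ≤ m then (if m = k then 1 else 0) * a (m - n) * (if n = 0 then 1 else 0) else 0) =
        a k := by
    rw [Finset.sum_eq_single 0, Finset.sum_eq_single k]
    · simp
    · intro m _ hm
      simp [hm]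
    · simp
    · intro n _ hn
      simp [hn]
    · simp
  rw [h2] at h1
  simpa [apply_ite norm, ite_pow] using h1

theorem HasSymbol.summable {B : H →L[ℂ] H} {a : ℕ → ℂ} (h : HasSymbol e w B a)
    (hw1 : ∀ n, w n ≤ 1) (hruns : HasUnitRuns w) {z : ℂ} (hz : z ∈ Metric.ball (0 : ℂ) 1) :
    Summable fun k => a k * z ^ k := by
  rw [mem_ball_zero_iff] at hz
  refine Summable.of_norm_bounded
    ((summable_geometric_of_lt_one (norm_nonneg z) hz).mul_left ‖B‖) fun k => ?_
  rw [norm_mul, norm_pow]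
  gcongr
  exact h.norm_coeff_le hw1 hruns k

/-- Test the Toeplitz form on `αₙ = (conj z)ⁿ` and `βₙ = zⁿ`. With `ρ = ‖z‖²` it equals `∑ ρⁿ s (K -
n)`, where `s` are the partial sums of the series. As `K → ∞` this tends to `f ∑ ρⁿ`, while the
bound tends to `‖B‖ ∑ ρⁿ`; divide. -/
theorem HasSymbol.norm_tsum_le {B : H →L[ℂ] H} {a : ℕ → ℂ} (h : HasSymbol e w B a)
    (hw1 : ∀ n, w n ≤ 1) (hruns : HasUnitRuns w) {z : ℂ} (hz : z ∈ Metric.ball (0 : ℂ) 1) :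
    ‖∑' k, a k * z ^ k‖ ≤ ‖B‖ := by
  have hs := h.summable hw1 hruns hz
  rw [mem_ball_zero_iff] at hz
  set f := ∑' k, a k * z ^ k with hf
  set ρ : ℝ := ‖z‖ ^ 2 with hρ
  have hρ0 : 0 ≤ ρ := by positivity
  have hρ1 : ρ < 1 := by
    rw [hρ]
    nlinarith [norm_nonneg z]
  set s : ℕ → ℂ := fun j => ∑ k ∈ Finset.range j, a k * z ^ k with hsdef
  have hfin : ∀ K, ‖∑ n ∈ Finset.range K, (ρ : ℂ) ^ n * s (K - n)‖ ≤
      ‖B‖ * ∑ n ∈ Finset.range K, ρ ^ n := by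
    intro K
    have h1 := h.norm_toeplitz_form_le hw1 hruns K (fun n => (starRingEnd ℂ) z ^ n)
      (fun n => z ^ n)
    have h2 : ∑ n ∈ Finset.range K, ∑ m ∈ Finset.range K,
        (if n ≤ m then z ^ m * a (m - n) * (starRingEnd ℂ) z ^ n else 0) =
          ∑ n ∈ Finset.range K, (ρ : ℂ) ^ n * s (K - n) := by
      refine Finset.sum_congr rfl fun n hn => ?_
      rw [← Finset.sum_filter]
      have : Finset.filter (fun m => n ≤ m) (Finset.range K) = Finset.Ico n K := by
        ext m
        simp [and_comm]
      rw [this, Finset.sum_Ico_eq_sum_range, hsdef, Finset.mul_sum]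
      refine Finset.sum_congr rfl fun k _ => ?_
      have hzz : (ρ : ℂ) = z * (starRingEnd ℂ) z := by
        rw [Complex.mul_conj', hρ]
        push_cast
        rfl
      rw [hzz, Nat.add_sub_cancel_left, mul_pow, pow_add]
      ring
    rw [h2] at h1
    have h3 : ∀ n : ℕ, (‖z‖ ^ n) ^ 2 = ρ ^ n := fun n => by rw [hρ]; ring
    simp only [norm_pow, RCLike.norm_conj, h3] at h1
    rwa [mul_assoc, Real.mul_self_sqrt (Finset.sum_nonneg fun _ _ => by positivity)] at h1
  have hsum : Summable fun n : ℕ => ρ ^ n := summable_geometric_of_lt_one hρ0 hρ1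
  have hst : Filter.Tendsto s Filter.atTop (nhds f) := hs.hasSum.tendsto_sum_nat
  have hsb : ∀ j, ‖s j‖ ≤ ∑' k, ‖a k * z ^ k‖ := fun j =>
    (norm_sum_le _ _).trans (hs.norm.sum_le_tsum _ fun _ _ => norm_nonneg _)
  -- Extending the finite sums by zero turns the limit in `K` into dominated convergence for series.
  have hlim1 : Filter.Tendsto
      (fun K : ℕ => ∑' n : ℕ, if n < K then (ρ : ℂ) ^ n * s (K - n) else 0) Filter.atTop
      (nhds (∑' n : ℕ, (ρ : ℂ) ^ n * f)) := by
    refine tendsto_tsum_of_dominated_convergence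
      (bound := fun n => ρ ^ n * ∑' k, ‖a k * z ^ k‖) (hsum.mul_right _) (fun n => ?_)
      (Filter.Eventually.of_forall fun K n => ?_)
    · have h1 : Filter.Tendsto (fun K : ℕ => (ρ : ℂ) ^ n * s (K - n)) Filter.atTop
          (nhds ((ρ : ℂ) ^ n * f)) :=
        (hst.comp (Filter.tendsto_sub_atTop_nat n)).const_mul _
      refine h1.congr' ?_
      filter_upwards [Filter.eventually_gt_atTop n] with K hK
      rw [if_pos hK]
    · split_ifs
      · rw [norm_mul, norm_pow, Complex.norm_real, Real.norm_of_nonneg hρ0]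
        gcongr
        exact hsb _
      · rw [norm_zero]
        exact mul_nonneg (by positivity) (tsum_nonneg fun _ => norm_nonneg _)
  have hpart : ∀ K : ℕ, (∑' n : ℕ, if n < K then (ρ : ℂ) ^ n * s (K - n) else 0) =
      ∑ n ∈ Finset.range K, (ρ : ℂ) ^ n * s (K - n) := by
    intro K
    rw [tsum_eq_sum (s := Finset.range K) fun n hn => if_neg (by simpa using hn)]
    exact Finset.sum_congr rfl fun n hn => if_pos (Finset.mem_range.1 hn)
  simp only [hpart] at hlim1
  have hlim2 := (hsum.hasSum.tendsto_sum_nat).const_mul ‖B‖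
  have hle := le_of_tendsto_of_tendsto' hlim1.norm hlim2 hfin
  rw [tsum_mul_right, norm_mul, mul_comm] at hle
  have hS : ‖∑' n : ℕ, (ρ : ℂ) ^ n‖ = ∑' n : ℕ, ρ ^ n := by
    have : ∑' n : ℕ, (ρ : ℂ) ^ n = ((∑' n : ℕ, ρ ^ n : ℝ) : ℂ) := by
      rw [Complex.ofReal_tsum]
      simp
    rw [this, Complex.norm_real, Real.norm_of_nonneg (tsum_nonneg fun _ => by positivity)]
  rw [hS] at hle
  have hpos : 0 < ∑' n : ℕ, ρ ^ n := by
    rw [tsum_geometric_of_lt_one hρ0 hρ1, inv_pos]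
    linarith
  exact le_of_mul_le_mul_right hle hpos

end LowerBound

/-! ### Taylor coefficients on the unit disk -/

section Taylor

theorem HasTaylorCoeffs.hasFPowerSeriesOnBall {f : ℂ → ℂ} {a : ℕ → ℂ} (h : HasTaylorCoeffs f a) :
    HasFPowerSeriesOnBall f (FormalMultilinearSeries.ofScalars ℂ a) 0 1 where
  r_le := by
    refine ENNReal.le_of_forall_nnreal_lt fun r hr => ?_
    refine FormalMultilinearSeries.le_radius_of_summable _ ?_
    simp only [FormalMultilinearSeries.ofScalars_norm]
    exact h.summable_norm r.2 (by exact_mod_cast hr)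
  r_pos := one_pos
  hasSum := by
    intro y hy
    have hy' : y ∈ Metric.ball (0 : ℂ) 1 := by
      rw [← Metric.eball_ofReal]
      simpa using hy
    simpa [FormalMultilinearSeries.ofScalars_apply_eq, mul_comm] using h y hy'

theorem HasTaylorCoeffs.unique {f : ℂ → ℂ} {a b : ℕ → ℂ} (ha : HasTaylorCoeffs f a)
    (hb : HasTaylorCoeffs f b) : a = b :=
  FormalMultilinearSeries.ofScalars_series_injective ℂ ℂ
    (ha.hasFPowerSeriesOnBall.hasFPowerSeriesAt.eq_formalMultilinearSeries
      hb.hasFPowerSeriesOnBall.hasFPowerSeriesAt)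

theorem HasTaylorCoeffs.differentiableOn {f : ℂ → ℂ} {a : ℕ → ℂ} (h : HasTaylorCoeffs f a) :
    DifferentiableOn ℂ f (Metric.ball 0 1) := by
  have := h.hasFPowerSeriesOnBall.differentiableOn
  rwa [← ENNReal.ofReal_one, Metric.eball_ofReal] at this

theorem exists_hasTaylorCoeffs {f : ℂ → ℂ} (hf : DifferentiableOn ℂ f (Metric.ball 0 1)) :
    ∃ a, HasTaylorCoeffs f a := by
  refine ⟨fun k => (k.factorial : ℂ)⁻¹ * iteratedDeriv k f 0, fun z hz => ?_⟩
  have h := Complex.hasSum_taylorSeries_on_ball hf hz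
  have heq : ∀ k : ℕ, (k.factorial : ℂ)⁻¹ • (z - 0) ^ k • iteratedDeriv k f 0 =
      (k.factorial : ℂ)⁻¹ * iteratedDeriv k f 0 * z ^ k := fun k => by
    simp only [sub_zero, smul_eq_mul]
    ring
  simpa only [heq] using h

theorem HasTaylorCoeffs.add {f g : ℂ → ℂ} {a b : ℕ → ℂ} (hf : HasTaylorCoeffs f a)
    (hg : HasTaylorCoeffs g b) : HasTaylorCoeffs (f + g) (a + b) := by
  intro z hz
  simpa [add_mul] using (hf z hz).add (hg z hz)

theorem HasTaylorCoeffs.mul {f g : ℂ → ℂ} {a b : ℕ → ℂ} (hf : HasTaylorCoeffs f a)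
    (hg : HasTaylorCoeffs g b) : HasTaylorCoeffs (f * g)
      (fun k => ∑ p ∈ Finset.HasAntidiagonal.antidiagonal k, a p.1 * b p.2) := by
  intro z hz
  have h1 := (hf z hz).summable.norm
  have h2 := (hg z hz).summable.norm
  have h3 := summable_norm_sum_mul_antidiagonal_of_summable_norm h1 h2
  have h4 := h3.of_norm.hasSum
  rw [← tsum_mul_tsum_eq_tsum_sum_antidiagonal_of_summable_norm h1 h2, (hf z hz).tsum_eq,
    (hg z hz).tsum_eq] at h4
  have heq : ∀ k : ℕ, (∑ p ∈ Finset.HasAntidiagonal.antidiagonal k, a p.1 * b p.2) * z ^ k =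
      ∑ p ∈ Finset.HasAntidiagonal.antidiagonal k, a p.1 * z ^ p.1 * (b p.2 * z ^ p.2) := ?_
  · rw [funext heq]
    exact h4
  intro k
  rw [Finset.sum_mul]
  refine Finset.sum_congr rfl fun p hp => ?_
  rw [← Finset.HasAntidiagonal.mem_antidiagonal.1 hp, pow_add]
  ring

theorem hasTaylorCoeffs_const (c : ℂ) :
    HasTaylorCoeffs (fun _ => c) (fun k => if k = 0 then c else 0) := by
  intro z _
  have h : ∀ k : ℕ, (if k = 0 then c else 0) * z ^ k = if k = 0 then c else 0 := fun k => by
    split_ifs with h <;> simp [h]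
  simpa only [h] using hasSum_ite_eq 0 c

theorem hasTaylorCoeffs_id : HasTaylorCoeffs id (fun k => if k = 1 then 1 else 0) := by
  intro z _
  have h : ∀ k : ℕ, (if k = 1 then 1 else 0) * z ^ k = if k = 1 then z else 0 := fun k => by
    split_ifs with h <;> simp [h]
  rw [funext h]
  exact hasSum_ite_eq 1 z

theorem HasTaylorCoeffs.congr {f g : ℂ → ℂ} {a : ℕ → ℂ} (hf : HasTaylorCoeffs f a)
    (h : ∀ z ∈ Metric.ball (0 : ℂ) 1, f z = g z) : HasTaylorCoeffs g a := fun z hz => by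
  rw [← h z hz]
  exact hf z hz

end Taylor

/-! ### The `H^∞` functional calculus -/

section Calculus

open Classical in
/-- Extension by `0` of a function on a subset of the complex plane. -/
noncomputable def extendZero {s : Set ℂ} (f : s → ℂ) : ℂ → ℂ :=
  fun z => if h : z ∈ s then f ⟨z, h⟩ else 0

theorem extendZero_of_mem {s : Set ℂ} (f : s → ℂ) {z : ℂ} (h : z ∈ s) :
    extendZero f z = f ⟨z, h⟩ := dif_pos h

theorem HolomorphicInDisk.exists_hasTaylorCoeffs {s : Set ℂ} {f : s → ℂ}
    (hf : HolomorphicInDisk f) (hs : Metric.ball 0 1 ⊆ s) :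
    ∃ a, HasTaylorCoeffs (extendZero f) a := by
  obtain ⟨g, hg, hfg⟩ := hf
  obtain ⟨a, ha⟩ := RandomShift.exists_hasTaylorCoeffs hg
  exact ⟨a, ha.congr fun z hz => by rw [extendZero_of_mem f (hs hz), hfg ⟨z, hs hz⟩ hz]⟩

/-- The Taylor coefficients of a function in `H^∞`. -/
noncomputable def taylorCoeff (f : hardyInfty) : ℕ → ℂ :=
  (HolomorphicInDisk.exists_hasTaylorCoeffs f.2 subset_rfl).choose

theorem hasTaylorCoeffs_taylorCoeff (f : hardyInfty) :
    HasTaylorCoeffs (extendZero f.1) (taylorCoeff f) :=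
  (HolomorphicInDisk.exists_hasTaylorCoeffs f.2 subset_rfl).choose_spec

theorem taylorCoeff_eq {f : hardyInfty} {g : ℂ → ℂ} {a : ℕ → ℂ} (hg : HasTaylorCoeffs g a)
    (h : ∀ z : Metric.ball (0 : ℂ) 1, f.1 z = g z) : taylorCoeff f = a :=
  (hasTaylorCoeffs_taylorCoeff f).unique (hg.congr fun z hz => by
    rw [extendZero_of_mem _ hz, h])

theorem norm_extendZero_le (f : hardyInfty) : ∀ z ∈ Metric.ball (0 : ℂ) 1,
    ‖extendZero f.1 z‖ ≤ ‖f‖ := fun z hz => by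
  rw [extendZero_of_mem _ hz]
  exact f.1.norm_coe_le_norm ⟨z, hz⟩

theorem hardyInfty_norm_le {f : hardyInfty} {C : ℝ} (hC : 0 ≤ C) :
    ‖f‖ ≤ C ↔ ∀ z : Metric.ball (0 : ℂ) 1, ‖f.1 z‖ ≤ C :=
  BoundedContinuousFunction.norm_le hC

theorem diskAlgebra_norm_le {f : diskAlgebra} {C : ℝ} (hC : 0 ≤ C) :
    ‖f‖ ≤ C ↔ ∀ z : Metric.closedBall (0 : ℂ) 1, ‖f.1 z‖ ≤ C :=
  ContinuousMap.norm_le _ hC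

/-- A bounded function with a Taylor expansion in the disk, as an element of `H^∞`. -/
theorem exists_hardyInfty {g : ℂ → ℂ} {a : ℕ → ℂ} (hg : HasTaylorCoeffs g a) {C : ℝ}
    (hC : 0 ≤ C) (hb : ∀ z ∈ Metric.ball (0 : ℂ) 1, ‖g z‖ ≤ C) :
    ∃ f : hardyInfty, ‖f‖ ≤ C ∧ (∀ z : Metric.ball (0 : ℂ) 1, f.1 z = g z) ∧
      taylorCoeff f = a := by
  have hcont : Continuous fun z : Metric.ball (0 : ℂ) 1 => g z :=
    hg.differentiableOn.continuousOn.domRestrict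
  let F : Metric.ball (0 : ℂ) 1 →ᵇ ℂ :=
    BoundedContinuousFunction.ofNormedAddCommGroup (fun z => g z) hcont C fun z => hb z z.2
  let f : hardyInfty := ⟨F, g, hg.differentiableOn, fun z _ => rfl⟩
  have hf : ∀ z : Metric.ball (0 : ℂ) 1, f.1 z = g z := fun z => rfl
  exact ⟨f, (hardyInfty_norm_le hC).2 fun z => hb z z.2, hf,
    taylorCoeff_eq hg hf⟩

theorem taylorCoeff_add (f g : hardyInfty) :
    taylorCoeff (f + g) = taylorCoeff f + taylorCoeff g :=
  taylorCoeff_eq ((hasTaylorCoeffs_taylorCoeff f).add (hasTaylorCoeffs_taylorCoeff g)) fun z => by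
    simp [extendZero_of_mem _ z.2]

theorem taylorCoeff_mul (f g : hardyInfty) : taylorCoeff (f * g) =
    fun k => ∑ p ∈ Finset.HasAntidiagonal.antidiagonal k, taylorCoeff f p.1 * taylorCoeff g p.2 :=
  taylorCoeff_eq ((hasTaylorCoeffs_taylorCoeff f).mul (hasTaylorCoeffs_taylorCoeff g)) fun z => by
    simp [extendZero_of_mem _ z.2]

theorem taylorCoeff_algebraMap (c : ℂ) :
    taylorCoeff (algebraMap ℂ hardyInfty c) = fun k => if k = 0 then c else 0 :=
  taylorCoeff_eq (hasTaylorCoeffs_const c) fun _ => rfl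

theorem exists_coordinate : ∃ ζ : hardyInfty, (∀ z : Metric.ball (0 : ℂ) 1, ζ.1 z = z) ∧
    taylorCoeff ζ = fun k => if k = 1 then 1 else 0 := by
  obtain ⟨f, -, h1, h2⟩ := exists_hardyInfty hasTaylorCoeffs_id zero_le_one fun z hz => by
    simpa using (mem_ball_zero_iff.1 hz).le
  exact ⟨f, h1, h2⟩

/-- The coordinate function in `H^∞`. -/
noncomputable def coordinate : hardyInfty := exists_coordinate.choose

theorem coordinate_apply (z : Metric.ball (0 : ℂ) 1) : coordinate.1 z = z :=
  exists_coordinate.choose_spec.1 z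

theorem taylorCoeff_coordinate : taylorCoeff coordinate = fun k => if k = 1 then 1 else 0 :=
  exists_coordinate.choose_spec.2

/-- Evaluation at a point of the disk. -/
noncomputable def evalDisk (z : Metric.ball (0 : ℂ) 1) : hardyInfty →ₐ[ℂ] ℂ where
  toFun f := f.1 z
  map_one' := rfl
  map_mul' _ _ := rfl
  map_zero' := rfl
  map_add' _ _ := rfl
  commutes' _ := rfl

theorem aeval_coordinate_apply (p : Polynomial ℂ) (z : Metric.ball (0 : ℂ) 1) :
    (Polynomial.aeval coordinate p).1 z = p.eval (z : ℂ) := by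
  have h := Polynomial.aeval_algHom_apply (evalDisk z) coordinate p
  have h1 : evalDisk z coordinate = z := coordinate_apply z
  rw [h1, Polynomial.coe_aeval_eq_eval] at h
  exact h.symm

theorem hasTaylorCoeffs_polynomial (p : Polynomial ℂ) :
    HasTaylorCoeffs (fun z => p.eval z) p.coeff := by
  intro z _
  have h : HasSum _ _ := hasSum_sum_of_ne_finset_zero
    (L := SummationFilter.unconditional ℕ) (f := fun k => p.coeff k * z ^ k)
    (s := Finset.range (p.natDegree + 1)) fun k hk => by
      rw [Polynomial.coeff_eq_zero_of_natDegree_lt (by simpa using hk), zero_mul]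
  rwa [← Polynomial.eval_eq_sum_range] at h

theorem taylorCoeff_aeval (p : Polynomial ℂ) :
    taylorCoeff (Polynomial.aeval coordinate p) = p.coeff :=
  taylorCoeff_eq (hasTaylorCoeffs_polynomial p) (aeval_coordinate_apply p)

/-- Polynomials are not norm dense in `H^∞`. A norm bound together with convergence of each
coefficient is available, and suffices for weak convergence of the operators. -/
theorem exists_polynomial_approx (f : hardyInfty) : ∃ p : ℕ → Polynomial ℂ,
    (∀ j, ‖Polynomial.aeval coordinate (p j)‖ ≤ ‖f‖ + 1) ∧
    ∀ k, Filter.Tendsto (fun j => (p j).coeff k) Filter.atTop (nhds (taylorCoeff f k)) := by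
  have ha := hasTaylorCoeffs_taylorCoeff f
  let r : ℕ → ℝ := fun j => 1 - 1 / ((j : ℝ) + 1)
  have hr1 : ∀ j, r j < 1 := fun j => by
    have : (0 : ℝ) < 1 / ((j : ℝ) + 1) := by positivity
    simp only [r]; linarith
  have hr0 : ∀ j, 0 ≤ r j := fun j => by
    have : 1 / ((j : ℝ) + 1) ≤ 1 := by
      rw [div_le_one (by positivity)]
      linarith [(Nat.cast_nonneg j : (0 : ℝ) ≤ j)]
    simp only [r]; linarith
  choose K hK using fun j =>
    ha.exists_norm_eval_dilatedTaylor_sub_le (hr0 j) (hr1 j) zero_lt_one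
  -- `K j` secures the norm bound; the second `j` ensures that each fixed coefficient is eventually
  -- kept.
  refine ⟨fun j => dilatedTaylor (taylorCoeff f) (r j) (max (K j) j), fun j => ?_, fun k => ?_⟩
  · refine (hardyInfty_norm_le (by positivity)).2 fun z => ?_
    have hz : ‖(z : ℂ)‖ < 1 := mem_ball_zero_iff.1 z.2
    rw [aeval_coordinate_apply]
    have h1 := hK j _ (le_max_left (K j) j) z hz.le
    have h2 := norm_extendZero_le f (r j * z) (by
      rw [mem_ball_zero_iff, norm_mul, Complex.norm_real, Real.norm_of_nonneg (hr0 j)]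
      nlinarith [norm_nonneg (z : ℂ), hr0 j, hr1 j])
    calc _ = ‖extendZero f.1 (r j * z) + ((dilatedTaylor (taylorCoeff f) (r j)
          (max (K j) j)).eval (z : ℂ) - extendZero f.1 (r j * z))‖ := by rw [add_sub_cancel]
      _ ≤ _ := (norm_add_le _ _).trans (add_le_add h2 h1)
  · have hrt : Filter.Tendsto (fun j => taylorCoeff f k * (r j : ℂ) ^ k) Filter.atTop
        (nhds (taylorCoeff f k)) := by
      have h0 : Filter.Tendsto r Filter.atTop (nhds 1) := by
        simpa [r] using tendsto_const_nhds.sub (tendsto_one_div_add_atTop_nhds_zero_nat (𝕜 := ℝ))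
      have h1 := (Complex.continuous_ofReal.tendsto 1).comp h0
      have h2 := (h1.pow k).const_mul (taylorCoeff f k)
      simpa using h2
    refine hrt.congr' ?_
    filter_upwards [Filter.eventually_gt_atTop k] with j hj
    rw [coeff_dilatedTaylor, if_pos (lt_max_of_lt_right hj)]

variable {H : Type*} [NormedAddCommGroup H] [InnerProductSpace ℂ H]
  {e : HilbertBasis ℕ ℂ H} {w : ℕ → ℝ}

theorem exists_hasSymbol_taylorCoeff (e : HilbertBasis ℕ ℂ H) (hw : ∀ j, |w j| ≤ 1)
    (f : hardyInfty) : ∃ B : H →L[ℂ] H, ‖B‖ ≤ ‖f‖ ∧ HasSymbol e w B (taylorCoeff f) :=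
  exists_hasSymbol ((hasTaylorCoeffs_taylorCoeff f).toeplitzBound (norm_extendZero_le f))
    (norm_nonneg f) hw

/-- The operator with the symbol `f` with respect to the weighted shift with weights `w`. -/
noncomputable def calculusFun (e : HilbertBasis ℕ ℂ H) (hw : ∀ j, |w j| ≤ 1) (f : hardyInfty) :
    H →L[ℂ] H :=
  (exists_hasSymbol_taylorCoeff e hw f).choose

theorem hasSymbol_calculusFun (hw : ∀ j, |w j| ≤ 1) (f : hardyInfty) :
    HasSymbol e w (calculusFun e hw f) (taylorCoeff f) :=
  (exists_hasSymbol_taylorCoeff e hw f).choose_spec.2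

theorem norm_calculusFun_le (hw : ∀ j, |w j| ≤ 1) (f : hardyInfty) : ‖calculusFun e hw f‖ ≤ ‖f‖ :=
  (exists_hasSymbol_taylorCoeff e hw f).choose_spec.1

theorem calculusFun_algebraMap (hw : ∀ j, |w j| ≤ 1) (c : ℂ) :
    calculusFun e hw (algebraMap ℂ hardyInfty c) = algebraMap ℂ (H →L[ℂ] H) c :=
  (hasSymbol_calculusFun hw _).unique (by
    rw [taylorCoeff_algebraMap]
    exact HasSymbol.algebraMap c)

theorem calculusFun_add (hw : ∀ j, |w j| ≤ 1) (f g : hardyInfty) :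
    calculusFun e hw (f + g) = calculusFun e hw f + calculusFun e hw g :=
  (hasSymbol_calculusFun hw _).unique (by
    rw [taylorCoeff_add]
    exact (hasSymbol_calculusFun hw f).add (hasSymbol_calculusFun hw g))

theorem calculusFun_mul (hw : ∀ j, |w j| ≤ 1) (f g : hardyInfty) :
    calculusFun e hw (f * g) = calculusFun e hw f * calculusFun e hw g :=
  (hasSymbol_calculusFun hw _).unique (by
    rw [taylorCoeff_mul]
    exact (hasSymbol_calculusFun hw f).mul (hasSymbol_calculusFun hw g))

/-- The `H^∞` functional calculus of a contractive weighted shift. -/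
noncomputable def calculus (e : HilbertBasis ℕ ℂ H) (hw : ∀ j, |w j| ≤ 1) :
    hardyInfty →ₐ[ℂ] (H →L[ℂ] H) where
  toFun := calculusFun e hw
  map_one' := by
    rw [← map_one (algebraMap ℂ hardyInfty), calculusFun_algebraMap, map_one]
  map_mul' := calculusFun_mul hw
  map_zero' := by
    rw [← map_zero (algebraMap ℂ hardyInfty), calculusFun_algebraMap, map_zero]
  map_add' := calculusFun_add hw
  commutes' := calculusFun_algebraMap hw

theorem hasSymbol_calculus (hw : ∀ j, |w j| ≤ 1) (f : hardyInfty) :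
    HasSymbol e w (calculus e hw f) (taylorCoeff f) :=
  hasSymbol_calculusFun hw f

theorem norm_calculus_le (hw : ∀ j, |w j| ≤ 1) (f : hardyInfty) : ‖calculus e hw f‖ ≤ ‖f‖ :=
  norm_calculusFun_le hw f

theorem norm_calculus (hw : ∀ j, |w j| ≤ 1) (hruns : HasUnitRuns w) (f : hardyInfty) :
    ‖calculus e hw f‖ = ‖f‖ := by
  refine le_antisymm (norm_calculus_le hw f) ?_
  refine (hardyInfty_norm_le (norm_nonneg _)).2 fun z => ?_
  have h := (hasSymbol_calculus (e := e) hw f).norm_tsum_le (fun n => (abs_le.1 (hw n)).2) hruns z.2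
  rwa [(hasTaylorCoeffs_taylorCoeff f z z.2).tsum_eq, extendZero_of_mem _ z.2] at h

theorem isometry_calculus (hw : ∀ j, |w j| ≤ 1) (hruns : HasUnitRuns w) :
    Isometry (calculus e hw) :=
  AddMonoidHomClass.isometry_of_norm _ (norm_calculus hw hruns)

/-- The lower bound shows that the power series of the symbol is bounded by `‖B‖` on the disk, so it
defines an element of `H^∞`; the symbol determines the operator. -/
theorem HasSymbol.exists_calculus_eq {B : H →L[ℂ] H} {a : ℕ → ℂ} (h : HasSymbol e w B a)
    (hw : ∀ j, |w j| ≤ 1) (hruns : HasUnitRuns w) : ∃ f, calculus e hw f = B := by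
  have hw1 : ∀ n, w n ≤ 1 := fun n => (abs_le.1 (hw n)).2
  obtain ⟨f, -, -, hf⟩ := exists_hardyInfty (g := fun z => ∑' k, a k * z ^ k) (a := a)
    (fun z hz => (h.summable hw1 hruns hz).hasSum) (norm_nonneg B)
    (fun z hz => h.norm_tsum_le hw1 hruns hz)
  refine ⟨f, (hasSymbol_calculus hw f).unique ?_⟩
  rwa [hf]

theorem calculus_coordinate (hw : ∀ j, |w j| ≤ 1) :
    calculus e hw coordinate = weightedShift e w := by
  refine (hasSymbol_calculus hw _).unique ?_
  rw [taylorCoeff_coordinate]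
  exact hasSymbol_weightedShift ⟨1, hw⟩

theorem calculus_aeval (hw : ∀ j, |w j| ≤ 1) (p : Polynomial ℂ) :
    calculus e hw (Polynomial.aeval coordinate p) = Polynomial.aeval (weightedShift e w) p := by
  rw [← Polynomial.aeval_algHom_apply, calculus_coordinate]

end Calculus

/-! ### Isometric isomorphisms from isometric homomorphisms -/

section IsometricEquiv

theorem exists_isometric_algEquiv {A B : Type*} [NormedRing A] [NormedAlgebra ℂ A]
    [NormedRing B] [NormedAlgebra ℂ B] (Θ : A →ₐ[ℂ] B) (hΘ : Isometry Θ) {S : Subalgebra ℂ B}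
    (hS : Θ.range = S) : ∃ φ : S ≃ₐ[ℂ] A, Isometry φ := by
  subst hS
  refine ⟨(AlgEquiv.ofInjective Θ hΘ.injective).symm, ?_⟩
  have h : Isometry (AlgEquiv.ofInjective Θ hΘ.injective) := fun x y => hΘ x y
  exact h.right_inv (AlgEquiv.ofInjective Θ hΘ.injective).apply_symm_apply

end IsometricEquiv

/-! ### The disk algebra and the Banach algebra of the shift -/

section DiskAlgebra

/-- Locally uniform limits of holomorphic functions are holomorphic. The resulting completeness
makes the image of the disk algebra under an isometry closed. -/
theorem isClosed_diskAlgebra :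
    IsClosed (diskAlgebra : Set C(Metric.closedBall (0 : ℂ) 1, ℂ)) := by
  refine IsSeqClosed.isClosed fun f g hf hfg => ?_
  have hlim : TendstoUniformlyOn (fun n => extendZero (f n)) (extendZero g) Filter.atTop
      (Metric.ball 0 1) := by
    rw [ContinuousMap.tendsto_iff_tendstoUniformly] at hfg
    rw [Metric.tendstoUniformlyOn_iff]
    intro ε hε
    filter_upwards [Metric.tendstoUniformly_iff.1 hfg ε hε] with n hn z hz
    have hz' := Metric.ball_subset_closedBall hz
    rw [extendZero_of_mem _ hz', extendZero_of_mem _ hz']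
    exact hn _
  have hd : DifferentiableOn ℂ (extendZero g) (Metric.ball 0 1) := by
    refine hlim.tendstoLocallyUniformlyOn.differentiableOn
      (Filter.Eventually.of_forall fun n => ?_) Metric.isOpen_ball
    obtain ⟨a, ha⟩ := HolomorphicInDisk.exists_hasTaylorCoeffs (hf n) Metric.ball_subset_closedBall
    exact ha.differentiableOn
  exact ⟨extendZero g, hd, fun z _ => (extendZero_of_mem _ z.2).symm⟩

instance : CompleteSpace diskAlgebra := isClosed_diskAlgebra.completeSpace_coe

/-- The coordinate function in the disk algebra. -/
def diskCoordinate : diskAlgebra :=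
  ⟨⟨fun z => (z : ℂ), continuous_subtype_val⟩, id, differentiableOn_id, fun _ _ => rfl⟩

/-- Evaluation at a point of the closed disk. -/
noncomputable def evalClosedDisk (z : Metric.closedBall (0 : ℂ) 1) : diskAlgebra →ₐ[ℂ] ℂ where
  toFun f := f.1 z
  map_one' := rfl
  map_mul' _ _ := rfl
  map_zero' := rfl
  map_add' _ _ := rfl
  commutes' _ := rfl

theorem aeval_diskCoordinate_apply (p : Polynomial ℂ) (z : Metric.closedBall (0 : ℂ) 1) :
    (Polynomial.aeval diskCoordinate p).1 z = p.eval (z : ℂ) := by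
  have h := Polynomial.aeval_algHom_apply (evalClosedDisk z) diskCoordinate p
  have h1 : evalClosedDisk z diskCoordinate = z := rfl
  rw [h1, Polynomial.coe_aeval_eq_eval] at h
  exact h.symm

theorem exists_polynomial_norm_sub_le (f : diskAlgebra) {ε : ℝ} (hε : 0 < ε) :
    ∃ p : Polynomial ℂ, ‖Polynomial.aeval diskCoordinate p - f‖ ≤ ε := by
  obtain ⟨a, ha⟩ := HolomorphicInDisk.exists_hasTaylorCoeffs f.2 Metric.ball_subset_closedBall
  have : CompactSpace (Metric.closedBall (0 : ℂ) 1) :=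
    isCompact_iff_compactSpace.1 (isCompact_closedBall _ _)
  have huc := CompactSpace.uniformContinuous_of_continuous f.1.continuous
  obtain ⟨δ, hδ, hδf⟩ := Metric.uniformContinuous_iff.1 huc (ε / 2) (half_pos hε)
  -- A dilation moves points of the disk by at most `1 - r < δ`; the maximum keeps `r` nonnegative
  -- when `δ` is large.
  set r : ℝ := max 0 (1 - δ / 2) with hr
  have hr0 : 0 ≤ r := le_max_left _ _
  have hr1 : r < 1 := max_lt one_pos (by linarith)
  have hrδ : 1 - r < δ := by linarith [le_max_right 0 (1 - δ / 2)]
  obtain ⟨K, hK⟩ := ha.exists_norm_eval_dilatedTaylor_sub_le hr0 hr1 (half_pos hε)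
  refine ⟨dilatedTaylor a r K, (diskAlgebra_norm_le hε.le).2 fun z => ?_⟩
  have hz : ‖(z : ℂ)‖ ≤ 1 := mem_closedBall_zero_iff.1 z.2
  have hrz : (r : ℂ) * z ∈ Metric.closedBall (0 : ℂ) 1 := by
    rw [mem_closedBall_zero_iff, norm_mul, Complex.norm_real, Real.norm_of_nonneg hr0]
    nlinarith [norm_nonneg (z : ℂ)]
  have h1 := hK K le_rfl z hz
  rw [extendZero_of_mem _ hrz] at h1
  have h2 : dist (f.1 ⟨r * z, hrz⟩) (f.1 z) < ε / 2 := by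
    apply hδf
    rw [Subtype.dist_eq, dist_eq_norm]
    have : (r : ℂ) * z - z = ((r - 1 : ℝ) : ℂ) * z := by push_cast; ring
    rw [this, norm_mul, Complex.norm_real, Real.norm_eq_abs, abs_sub_comm,
      abs_of_pos (by linarith)]
    nlinarith [norm_nonneg (z : ℂ)]
  rw [dist_eq_norm] at h2
  have h3 : (Polynomial.aeval diskCoordinate (dilatedTaylor a r K) - f).1 z =
      ((dilatedTaylor a r K).eval (z : ℂ) - f.1 ⟨r * z, hrz⟩) + (f.1 ⟨r * z, hrz⟩ - f.1 z) := by
    rw [sub_add_sub_cancel, ← aeval_diskCoordinate_apply]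
    rfl
  rw [h3]
  exact (norm_add_le _ _).trans (by linarith)

/-- Restriction from the closed to the open disk. -/
noncomputable def restrictDisk : diskAlgebra →ₐ[ℂ] hardyInfty where
  toFun f := ⟨(BoundedContinuousFunction.mkOfCompact f.1).compContinuous
    ⟨Set.inclusion Metric.ball_subset_closedBall, continuous_inclusion _⟩, by
      obtain ⟨g, hg, hfg⟩ := f.2
      exact ⟨g, hg, fun z hz => hfg ⟨z, Metric.ball_subset_closedBall z.2⟩ hz⟩⟩
  map_one' := rfl
  map_mul' _ _ := rfl
  map_zero' := rfl
  map_add' _ _ := rfl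
  commutes' _ := rfl

/-- Boundary values are radial limits of values in the open disk, by continuity. -/
theorem norm_restrictDisk (f : diskAlgebra) : ‖restrictDisk f‖ = ‖f‖ := by
  refine le_antisymm ((hardyInfty_norm_le (norm_nonneg _)).2 fun z => ?_)
    ((diskAlgebra_norm_le (norm_nonneg _)).2 fun z => ?_)
  · exact f.1.norm_coe_le_norm _
  · have hz : ‖(z : ℂ)‖ ≤ 1 := mem_closedBall_zero_iff.1 z.2
    let r : ℕ → ℝ := fun j => 1 - 1 / ((j : ℝ) + 1)
    have hr1 : ∀ j, r j < 1 := fun j => by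
      have : (0 : ℝ) < 1 / ((j : ℝ) + 1) := by positivity
      simp only [r]; linarith
    have hr0 : ∀ j, 0 ≤ r j := fun j => by
      have : 1 / ((j : ℝ) + 1) ≤ 1 := by
        rw [div_le_one (by positivity)]
        linarith [(Nat.cast_nonneg j : (0 : ℝ) ≤ j)]
      simp only [r]; linarith
    have hmem : ∀ j, (r j : ℂ) * z ∈ Metric.ball (0 : ℂ) 1 := fun j => by
      rw [mem_ball_zero_iff, norm_mul, Complex.norm_real, Real.norm_of_nonneg (hr0 j)]
      nlinarith [norm_nonneg (z : ℂ), hr0 j, hr1 j]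
    have h0 : Filter.Tendsto r Filter.atTop (nhds 1) := by
      simpa [r] using tendsto_const_nhds.sub (tendsto_one_div_add_atTop_nhds_zero_nat (𝕜 := ℝ))
    have h1 : Filter.Tendsto (fun j => (⟨(r j : ℂ) * z, Metric.ball_subset_closedBall (hmem j)⟩ :
        Metric.closedBall (0 : ℂ) 1)) Filter.atTop (nhds z) := by
      rw [tendsto_subtype_rng]
      simpa using ((Complex.continuous_ofReal.tendsto 1).comp h0).mul_const (z : ℂ)
    have h2 := ((f.1.continuous.tendsto z).comp h1).norm
    refine le_of_tendsto h2 (Filter.Eventually.of_forall fun j => ?_)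
    exact (restrictDisk f).1.norm_coe_le_norm ⟨_, hmem j⟩

theorem isometry_restrictDisk : Isometry restrictDisk :=
  AddMonoidHomClass.isometry_of_norm _ norm_restrictDisk

theorem restrictDisk_diskCoordinate : restrictDisk diskCoordinate = coordinate := by
  ext z
  exact (coordinate_apply z).symm

variable {H : Type*} [NormedAddCommGroup H] [InnerProductSpace ℂ H]
  {e : HilbertBasis ℕ ℂ H} {w : ℕ → ℝ}

theorem range_calculus_comp_restrictDisk (hw : ∀ j, |w j| ≤ 1) (hruns : HasUnitRuns w) :
    ((calculus e hw).comp restrictDisk).range = banachAlgebraGen (weightedShift e w) := by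
  set Θ := (calculus e hw).comp restrictDisk with hΘ
  have hiso : Isometry Θ := (isometry_calculus hw hruns).comp isometry_restrictDisk
  have hpoly : ∀ p : Polynomial ℂ, Θ (Polynomial.aeval diskCoordinate p) =
      Polynomial.aeval (weightedShift e w) p := by
    intro p
    rw [← Polynomial.aeval_algHom_apply]
    congr 2
    rw [hΘ, AlgHom.comp_apply, restrictDisk_diskCoordinate, calculus_coordinate]
  apply le_antisymm
  · rintro _ ⟨f, rfl⟩
    have hmem : f ∈ closure (Set.range fun p : Polynomial ℂ => Polynomial.aeval diskCoordinate p) := by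
      rw [Metric.mem_closure_iff]
      intro ε hε
      obtain ⟨p, hp⟩ := exists_polynomial_norm_sub_le f (half_pos hε)
      exact ⟨_, ⟨p, rfl⟩, by rw [dist_comm, dist_eq_norm]; linarith⟩
    refine map_mem_closure hiso.continuous hmem ?_
    rintro _ ⟨p, rfl⟩
    exact ⟨p, (hpoly p).symm⟩
  · refine Subalgebra.topologicalClosure_minimal ?_ ?_
    · rintro _ ⟨p, rfl⟩
      exact ⟨_, hpoly p⟩
    · exact hiso.isClosedEmbedding.isClosed_range

end DiskAlgebra

/-! ### Bounded convergence in the weak operator and weak* topologies -/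

section Convergence

variable {H : Type*} [NormedAddCommGroup H] [InnerProductSpace ℂ H] {e : HilbertBasis ℕ ℂ H}

/-- A bounded sequence of functionals that converges to `0` on an orthonormal basis converges
to `0` pointwise. -/
theorem tendsto_zero_of_tendsto_zero_basis (e : HilbertBasis ℕ ℂ H) {L : ℕ → H →L[ℂ] ℂ} {C : ℝ}
    (hC : ∀ j, ‖L j‖ ≤ C) (h : ∀ n, Filter.Tendsto (fun j => L j (e n)) Filter.atTop (nhds 0))
    (x : H) : Filter.Tendsto (fun j => L j x) Filter.atTop (nhds 0) := by
  have hC0 : 0 ≤ C := (norm_nonneg _).trans (hC 0)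
  rw [Metric.tendsto_nhds]
  intro ε hε
  have hs := (hasSum_inner_smul (e := e) x).tendsto_sum_nat
  obtain ⟨N, hN⟩ := ((Metric.tendsto_nhds.1 hs) (ε / (2 * (C + 1))) (by positivity)).exists
  set s := ∑ n ∈ Finset.range N, inner ℂ (e n) x • e n with hsdef
  have hLs : Filter.Tendsto (fun j => L j s) Filter.atTop (nhds 0) := by
    simp only [hsdef, map_sum, map_smul]
    have := tendsto_finsetSum (Finset.range N) fun n _ => (h n).const_smul (inner ℂ (e n) x)
    simpa using this
  filter_upwards [(Metric.tendsto_nhds.1 hLs) (ε / 2) (half_pos hε)] with j hj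
  rw [dist_zero_right] at hj ⊢
  rw [dist_eq_norm, norm_sub_rev] at hN
  have h1 : ‖L j (x - s)‖ ≤ C * (ε / (2 * (C + 1))) :=
    ((L j).le_opNorm _).trans (mul_le_mul (hC j) hN.le (norm_nonneg _) hC0)
  have h2 : C * (ε / (2 * (C + 1))) ≤ ε / 2 := by
    rw [mul_div_assoc', div_le_div_iff₀ (by positivity) (by positivity)]
    nlinarith
  calc ‖L j x‖ = ‖L j (x - s) + L j s‖ := by rw [← map_add, sub_add_cancel]
    _ ≤ ‖L j (x - s)‖ + ‖L j s‖ := norm_add_le _ _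
    _ < ε := by linarith

/-- A bounded sequence of operators whose matrix entries converge converges in the weak operator
topology. -/
theorem tendsto_inner_of_tendsto_entries (e : HilbertBasis ℕ ℂ H) {A : ℕ → H →L[ℂ] H}
    {B : H →L[ℂ] H} {C : ℝ} (hC : ∀ j, ‖A j‖ ≤ C)
    (h : ∀ m n, Filter.Tendsto (fun j => inner ℂ (e m) (A j (e n))) Filter.atTop
      (nhds (inner ℂ (e m) (B (e n))))) (y x : H) :
    Filter.Tendsto (fun j => inner ℂ y (A j x)) Filter.atTop (nhds (inner ℂ y (B x))) := by
  have hD : ∀ j, ‖A j - B‖ ≤ C + ‖B‖ := fun j => (norm_sub_le _ _).trans (by gcongr; exact hC j)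
  have hC0 : 0 ≤ C + ‖B‖ := (norm_nonneg _).trans (hD 0)
  have h0 : ∀ m n, Filter.Tendsto (fun j => inner ℂ (e m) ((A j - B) (e n))) Filter.atTop
      (nhds 0) := by
    intro m n
    have := (h m n).sub_const (inner ℂ (e m) (B (e n)))
    simpa [inner_sub_right] using this
  -- Pass from basis vectors to all vectors one argument at a time: first on the right here, then on
  -- the left in `h2`, after conjugation.
  have h1 : ∀ m x, Filter.Tendsto (fun j => inner ℂ (e m) ((A j - B) x)) Filter.atTop
      (nhds 0) := by
    intro m x
    refine tendsto_zero_of_tendsto_zero_basis e (L := fun j => innerSL ℂ (e m) ∘L (A j - B))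
      (C := C + ‖B‖) (fun j => ?_) (fun n => h0 m n) x
    refine (ContinuousLinearMap.opNorm_comp_le _ _).trans ?_
    rw [innerSL_apply_norm, e.orthonormal.1, one_mul]
    exact hD j
  have h2 : Filter.Tendsto (fun j => inner ℂ ((A j - B) x) y) Filter.atTop (nhds 0) := by
    refine tendsto_zero_of_tendsto_zero_basis e (L := fun j => innerSL ℂ ((A j - B) x))
      (C := (C + ‖B‖) * ‖x‖) (fun j => ?_) (fun m => ?_) y
    · rw [innerSL_apply_norm]
      exact ((A j - B).le_opNorm x).trans (by gcongr; exact hD j)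
    · have := (Complex.continuous_conj.tendsto 0).comp (h1 m x)
      simpa [Function.comp_def, inner_conj_symm] using this
  have h3 := ((Complex.continuous_conj.tendsto 0).comp h2).add_const (inner ℂ y (B x))
  have h4 : ∀ j, (starRingEnd ℂ) (inner ℂ ((A j - B) x) y) + inner ℂ y (B x) =
      inner ℂ y (A j x) := by
    intro j
    rw [inner_conj_symm, sub_apply, inner_sub_right, sub_add_cancel]
  simpa [Function.comp_def, h4] using h3

theorem sum_norm_inner_mul_le (e : HilbertBasis ℕ ℂ H) (y z : H) (s : Finset ℕ) :
    ∑ k ∈ s, ‖inner ℂ y (e k) * inner ℂ (e k) z‖ ≤ ‖y‖ * ‖z‖ := by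
  simp only [norm_mul]
  refine (Real.sum_mul_le_sqrt_mul_sqrt s _ _).trans ?_
  gcongr
  · rw [← Real.sqrt_sq (norm_nonneg y)]
    refine Real.sqrt_le_sqrt ?_
    simp only [norm_inner_symm y]
    exact e.orthonormal.sum_inner_products_le y
  · rw [← Real.sqrt_sq (norm_nonneg z)]
    exact Real.sqrt_le_sqrt (e.orthonormal.sum_inner_products_le z)

/-- The trace of `A S`, in terms of a representation of the trace-class operator `S`. -/
theorem trace_comp_eq_tsum (e : HilbertBasis ℕ ℂ H) {S : H →L[ℂ] H} {x y : ℕ → H}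
    (hxy : Summable fun n => ‖x n‖ * ‖y n‖)
    (hS : ∀ v : H, HasSum (fun n => inner ℂ (y n) v • x n) (S v)) (A : H →L[ℂ] H) :
    trace e (A ∘L S) = ∑' n, inner ℂ (y n) (A (x n)) := by
  let F : ℕ → ℕ → ℂ := fun n k => inner ℂ (y n) (e k) * inner ℂ (e k) (A (x n))
  have hrow : ∀ n, Summable fun k => ‖F n k‖ := fun n =>
    summable_of_sum_le (fun _ => norm_nonneg _) (sum_norm_inner_mul_le e (y n) (A (x n)))
  -- Row `n` has absolute sum at most `‖A‖ ‖x n‖ ‖y n‖`, which justifies exchanging the two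
  -- summations.
  have hsum : Summable (Function.uncurry F) := by
    refine Summable.of_norm ?_
    rw [summable_prod_of_nonneg fun _ => norm_nonneg _]
    refine ⟨hrow, ?_⟩
    refine Summable.of_nonneg_of_le (fun n => tsum_nonneg fun _ => norm_nonneg _) (fun n => ?_)
      (hxy.mul_left ‖A‖)
    refine ((hrow n).tsum_le_of_sum_le (sum_norm_inner_mul_le e (y n) (A (x n)))).trans ?_
    calc ‖y n‖ * ‖A (x n)‖ ≤ ‖y n‖ * (‖A‖ * ‖x n‖) := by gcongr; exact A.le_opNorm _
      _ = _ := by ring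
  have h1 : ∀ k, inner ℂ (e k) ((A ∘L S) (e k)) = ∑' n, F n k := by
    intro k
    have := (hS (e k)).mapL (innerSL ℂ (e k) ∘L A)
    simpa [F, inner_smul_right] using this.tsum_eq.symm
  rw [trace, tsum_congr h1, hsum.tsum_comm]
  exact tsum_congr fun n => e.tsum_inner_mul_inner _ _

theorem tendsto_trace_of_tendsto_inner (e : HilbertBasis ℕ ℂ H) {A : ℕ → H →L[ℂ] H}
    {B : H →L[ℂ] H} {C : ℝ} (hC : ∀ j, ‖A j‖ ≤ C)
    (h : ∀ y x, Filter.Tendsto (fun j => inner ℂ y (A j x)) Filter.atTop (nhds (inner ℂ y (B x))))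
    {S : H →L[ℂ] H} (hS : IsTraceClass S) :
    Filter.Tendsto (fun j => trace e (A j ∘L S)) Filter.atTop (nhds (trace e (B ∘L S))) := by
  obtain ⟨x, y, hxy, hS⟩ := hS
  simp only [trace_comp_eq_tsum e hxy hS]
  refine tendsto_tsum_of_dominated_convergence (hxy.mul_left C) (fun n => h _ _)
    (Filter.Eventually.of_forall fun j n => ?_)
  calc ‖inner ℂ (y n) (A j (x n))‖ ≤ ‖y n‖ * ‖A j (x n)‖ := norm_inner_le_norm _ _
    _ ≤ ‖y n‖ * (C * ‖x n‖) := by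
        gcongr
        exact ((A j).le_opNorm _).trans (by gcongr; exact hC j)
    _ = _ := by ring

/-- A matrix entry is the trace pairing with the rank-one operator `v ↦ ⟨e m, v⟩ e n`. -/
theorem continuous_entry_weakStar (e : HilbertBasis ℕ ℂ H) (m n : ℕ) :
    @Continuous _ _ (weakStarTopology e) _
      fun B : H →L[ℂ] H => inner ℂ (e m) (B (e n)) := by
  let S : H →L[ℂ] H := (innerSL ℂ (e m)).smulRight (e n)
  have hS : IsTraceClass S := by
    refine ⟨fun i => if i = 0 then e n else 0, fun i => if i = 0 then e m else 0, ?_, fun v => ?_⟩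
    · exact summable_of_ne_finset_zero (s := {0}) fun i hi => by
        rw [Finset.mem_singleton] at hi
        simp [hi]
    · have := hasSum_ite_eq (0 : ℕ) (S v)
      have h : ∀ i : ℕ, inner ℂ (if i = 0 then e m else 0) v • (if i = 0 then e n else 0) =
          if i = 0 then S v else 0 := fun i => by split_ifs <;> simp [S]
      simpa only [h] using this
  have heq : (fun B : H →L[ℂ] H => inner ℂ (e m) (B (e n))) = fun B => trace e (B ∘L S) := by
    ext B
    rw [trace, tsum_eq_single m]
    · simp [S, e.orthonormal.1]
    · intro k hk
      simp [S, orthonormal_iff_ite.1 e.orthonormal, hk.symm]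
  rw [heq]
  exact continuous_iInf_dom (i := ⟨S, hS⟩) continuous_induced_dom

theorem mem_dualClosure_of_tendsto_inner (e : HilbertBasis ℕ ℂ H) {A : ℕ → H →L[ℂ] H}
    {B : H →L[ℂ] H} {C : ℝ} (hC : ∀ j, ‖A j‖ ≤ C)
    (h : ∀ y x, Filter.Tendsto (fun j => inner ℂ y (A j x)) Filter.atTop (nhds (inner ℂ y (B x))))
    {s : Set (H →L[ℂ] H)} (hA : ∀ j, A j ∈ s) : B ∈ @closure _ (weakStarTopology e) s := by
  have ht : Filter.Tendsto A Filter.atTop (@nhds _ (weakStarTopology e) B) := by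
    rw [weakStarTopology, nhds_iInf, Filter.tendsto_iInf]
    intro S
    rw [nhds_induced, Filter.tendsto_comap_iff]
    exact tendsto_trace_of_tendsto_inner e hC h S.2
  let := weakStarTopology e
  exact mem_closure_of_tendsto (X := H →L[ℂ] H) ht (Filter.Eventually.of_forall hA)

theorem mem_wotClosure_of_tendsto_inner [CompleteSpace H] {A : ℕ → H →L[ℂ] H} {B : H →L[ℂ] H}
    (h : ∀ y x, Filter.Tendsto (fun j => inner ℂ y (A j x)) Filter.atTop (nhds (inner ℂ y (B x))))
    {s : Set (H →L[ℂ] H)} (hA : ∀ j, A j ∈ s) :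
    ContinuousLinearMapWOT.ofCLM B ∈ closure (ContinuousLinearMapWOT.ofCLM '' s) := by
  refine mem_closure_of_tendsto (f := fun j => ContinuousLinearMapWOT.ofCLM (A j))
    (b := Filter.atTop) ?_ (Filter.Eventually.of_forall fun j => ⟨A j, hA j, rfl⟩)
  rw [ContinuousLinearMapWOT.tendsto_iff_forall_inner_apply_tendsto]
  exact fun x y => h y x

end Convergence

/-! ### The weakly closed algebra and the dual algebra -/

section SymbolAlgebra

variable {H : Type*} [NormedAddCommGroup H] [InnerProductSpace ℂ H] {e : HilbertBasis ℕ ℂ H}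
  {w : ℕ → ℝ}

theorem HasUnitRuns.exists_weightProd_ne_zero (hruns : HasUnitRuns w) (k : ℕ) :
    ∃ n, weightProd w n (n + k) ≠ 0 := by
  obtain ⟨N, hN⟩ := hruns k 1 one_pos
  refine ⟨N, Finset.prod_ne_zero_iff.2 fun j hj => ?_⟩
  rw [Finset.mem_Ico] at hj
  have := hN (j - N) (by omega)
  rw [Nat.add_sub_cancel' hj.1, sub_self] at this
  exact_mod_cast this.ne'

/-- Along each diagonal the entries must be proportional to the weight products.
Cross-multiplication makes this linear in the entries even if weights vanish, and one nonzero
product per diagonal recovers the symbol. Leaving `τ` general covers both weak topologies. -/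
theorem isClosed_setOf_hasSymbol (hne : ∀ k, ∃ n, weightProd w n (n + k) ≠ 0)
    (τ : TopologicalSpace (H →L[ℂ] H))
    (hτ : ∀ m n, @Continuous _ _ τ _ fun B : H →L[ℂ] H => inner ℂ (e m) (B (e n))) :
    @IsClosed _ τ {B : H →L[ℂ] H | ∃ a, HasSymbol e w B a} := by
  have heq : {B : H →L[ℂ] H | ∃ a, HasSymbol e w B a} =
      {B | ∀ m n, m < n → inner ℂ (e m) (B (e n)) = 0} ∩
      {B | ∀ k n l, inner ℂ (e (n + k)) (B (e n)) * weightProd w l (l + k) =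
        inner ℂ (e (l + k)) (B (e l)) * weightProd w n (n + k)} := by
    ext B
    constructor
    · rintro ⟨a, ha⟩
      refine ⟨fun m n hmn => by rw [ha, if_neg (not_le.2 hmn)], fun k n l => ?_⟩
      rw [ha, ha, if_pos (Nat.le_add_right _ _), if_pos (Nat.le_add_right _ _),
        Nat.add_sub_cancel_left, Nat.add_sub_cancel_left]
      ring
    · rintro ⟨h1, h2⟩
      choose N hN using hne
      refine ⟨fun k => inner ℂ (e (N k + k)) (B (e (N k))) / weightProd w (N k) (N k + k),
        fun m n => ?_⟩
      split_ifs with h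
      · obtain ⟨k, rfl⟩ := Nat.exists_eq_add_of_le h
        rw [Nat.add_sub_cancel_left, div_mul_eq_mul_div, eq_div_iff (hN k)]
        exact h2 k n (N k)
      · exact h1 m n (not_le.1 h)
  rw [heq]
  let := τ
  refine IsClosed.inter ?_ ?_
  · simp only [Set.ofPred_forall]
    exact isClosed_iInter fun m => isClosed_iInter fun n => isClosed_iInter fun _ =>
      isClosed_eq (hτ m n) continuous_const
  · simp only [Set.ofPred_forall]
    exact isClosed_iInter fun k => isClosed_iInter fun n => isClosed_iInter fun l =>
      isClosed_eq ((hτ _ _).mul continuous_const) ((hτ _ _).mul continuous_const)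

theorem exists_polynomial_tendsto_of_hasSymbol (hw : ∀ j, |w j| ≤ 1)
    (hruns : HasUnitRuns w) {B : H →L[ℂ] H} {a : ℕ → ℂ}
    (h : HasSymbol e w B a) : ∃ (A : ℕ → H →L[ℂ] H) (C : ℝ), (∀ j, ‖A j‖ ≤ C) ∧
      (∀ j, A j ∈ (polynomialsIn (weightedShift e w) : Set (H →L[ℂ] H))) ∧
      ∀ y x, Filter.Tendsto (fun j => inner ℂ y (A j x)) Filter.atTop
        (nhds (inner ℂ y (B x))) := by
  obtain ⟨f, rfl⟩ := h.exists_calculus_eq hw hruns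
  obtain ⟨p, hp1, hp2⟩ := exists_polynomial_approx f
  have hbd : ∀ j, ‖calculus e hw (Polynomial.aeval coordinate (p j))‖ ≤ ‖f‖ + 1 := fun j =>
    (norm_calculus_le hw _).trans (hp1 j)
  refine ⟨_, _, hbd, fun j => ⟨p j, (calculus_aeval hw (p j)).symm⟩,
    tendsto_inner_of_tendsto_entries e hbd fun m n => ?_⟩
  simp only [hasSymbol_calculus hw _ m n, taylorCoeff_aeval]
  split_ifs
  · exact (hp2 _).mul_const _
  · exact tendsto_const_nhds

theorem polynomialsIn_subset_setOf_hasSymbol (hw : ∀ j, |w j| ≤ 1) :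
    (polynomialsIn (weightedShift e w) : Set (H →L[ℂ] H)) ⊆ {B | ∃ a, HasSymbol e w B a} := by
  rintro _ ⟨p, rfl⟩
  have h := hasSymbol_calculus (e := e) hw (Polynomial.aeval coordinate p)
  rw [calculus_aeval] at h
  exact ⟨_, h⟩

theorem dualAlgebraGen_weightedShift (hw : ∀ j, |w j| ≤ 1) (hruns : HasUnitRuns w) :
    dualAlgebraGen e (weightedShift e w) = {B | ∃ a, HasSymbol e w B a} := by
  refine Set.Subset.antisymm ?_ ?_
  · let := weakStarTopology e
    exact closure_minimal (polynomialsIn_subset_setOf_hasSymbol hw)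
      (isClosed_setOf_hasSymbol hruns.exists_weightProd_ne_zero _ (continuous_entry_weakStar e))
  · rintro B ⟨a, ha⟩
    obtain ⟨A, C, hC, hA, ht⟩ := exists_polynomial_tendsto_of_hasSymbol hw hruns ha
    exact mem_dualClosure_of_tendsto_inner e hC ht hA

theorem weaklyClosedAlgebraGen_weightedShift (hw : ∀ j, |w j| ≤ 1)
    (hruns : HasUnitRuns w) [CompleteSpace H] :
    weaklyClosedAlgebraGen (weightedShift e w) = {B | ∃ a, HasSymbol e w B a} := by
  refine Set.Subset.antisymm ?_ ?_
  -- The weak operator topology lives on a type copy of the operators; `τ` pulls it back.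
  · let τ : TopologicalSpace (H →L[ℂ] H) :=
      TopologicalSpace.induced ContinuousLinearMapWOT.ofCLM inferInstance
    have hcl := isClosed_setOf_hasSymbol (e := e) hruns.exists_weightProd_ne_zero τ fun m n => by
      have h1 : Continuous fun B : H →WOT[ℂ] H => inner ℂ (e m) (B (e n)) :=
        ContinuousLinearMapWOT.continuous_dual_apply (e n) (innerSL ℂ (e m))
      exact h1.comp continuous_induced_dom
    intro B hB
    have hB' : B ∈ @closure _ τ (polynomialsIn (weightedShift e w) : Set (H →L[ℂ] H)) :=
      closure_induced.2 hB
    exact (@closure_minimal (H →L[ℂ] H) τ _ _ (polynomialsIn_subset_setOf_hasSymbol hw) hcl) hB'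
  · rintro B ⟨a, ha⟩
    obtain ⟨A, C, hC, hA, ht⟩ := exists_polynomial_tendsto_of_hasSymbol hw hruns ha
    exact mem_wotClosure_of_tendsto_inner ht hA

end SymbolAlgebra

/-! ### Commutant and double commutant -/

section Commutant

variable {H : Type*} [NormedAddCommGroup H] [InnerProductSpace ℂ H] {e : HilbertBasis ℕ ℂ H}
  {w : ℕ → ℝ}

theorem HasSymbol.commute {A B : H →L[ℂ] H} {a b : ℕ → ℂ} (hA : HasSymbol e w A a)
    (hB : HasSymbol e w B b) : A * B = B * A := by
  refine (hA.mul hB).unique ?_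
  convert hB.mul hA using 2 with k
  conv_lhs => rw [← Finset.HasAntidiagonal.map_swap_antidiagonal, Finset.sum_map]
  exact Finset.sum_congr rfl fun p _ => mul_comm _ _

theorem inner_basis_weightedShift (h : ∃ C : ℝ, ∀ n, |w n| ≤ C) (x : H) (m : ℕ) :
    inner ℂ (e m) (weightedShift e w x) = shiftCoord w (fun n => inner ℂ (e n) x) m := by
  have h1 := (hasSum_apply (e := e) (weightedShift e w) x).mapL (innerSL ℂ (e m))
  simp only [map_smul, innerSL_apply_apply, weightedShift_apply_basis e h,
    orthonormal_iff_ite.1 e.orthonormal, smul_eq_mul] at h1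
  rw [← h1.tsum_eq]
  cases m with
  | zero => simp [shiftCoord]
  | succ m =>
    rw [tsum_eq_single m fun n hn => by rw [if_neg (by omega), mul_zero, mul_zero]]
    simp [shiftCoord, mul_comm]

/-- Comparing entries of `T B` and `B T` expresses `w n` times column `n + 1` of `B` through column
`n`. As `w n ≠ 0`, column `0` determines `B`, and the symbol is read off from it. -/
theorem exists_hasSymbol_of_commute (h : ∃ C : ℝ, ∀ n, |w n| ≤ C) (hw0 : ∀ n, w n ≠ 0)
    {B : H →L[ℂ] H} (hB : weightedShift e w * B = B * weightedShift e w) :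
    ∃ a, HasSymbol e w B a := by
  have hrec : ∀ m n, (w n : ℂ) * inner ℂ (e m) (B (e (n + 1))) =
      shiftCoord w (fun k => inner ℂ (e k) (B (e n))) m := by
    intro m n
    rw [← inner_basis_weightedShift h, ← mul_apply_eq_comp, hB, mul_apply_eq_comp,
      weightedShift_apply_basis e h, map_smul, inner_smul_right]
  have hwc : ∀ n, (w n : ℂ) ≠ 0 := fun n => by exact_mod_cast hw0 n
  refine ⟨fun k => inner ℂ (e k) (B (e 0)) / weightProd w 0 k, fun m n => ?_⟩
  induction n generalizing m with
  | zero =>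
    rw [if_pos (Nat.zero_le _), Nat.sub_zero, div_mul_cancel₀ _ (weightProd_ne_zero hw0 0 m)]
  | succ n ih =>
    apply mul_left_cancel₀ (hwc n)
    rw [hrec]
    cases m with
    | zero => simp [shiftCoord]
    | succ m =>
      rw [shiftCoord, ih]
      by_cases hnm : n ≤ m
      · rw [if_pos hnm, if_pos (Nat.succ_le_succ hnm), Nat.add_sub_add_right]
        have h1 : weightProd w n (m + 1) = w n * weightProd w (n + 1) (m + 1) := by
          rw [← weightProd_mul w (Nat.le_succ n) (Nat.succ_le_succ hnm),
            weightProd_succ w le_rfl, weightProd_self, one_mul]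
        have h2 := weightProd_succ w hnm
        rw [h1] at h2
        linear_combination (-inner ℂ (e (m - n)) (B (e 0)) / weightProd w 0 (m - n)) * h2
      · rw [if_neg hnm, if_neg (by omega), mul_zero, mul_zero]

theorem coe_commutant_weightedShift (h : ∃ C : ℝ, ∀ n, |w n| ≤ C) (hw0 : ∀ n, w n ≠ 0) :
    (commutant (weightedShift e w) : Set (H →L[ℂ] H)) = {B | ∃ a, HasSymbol e w B a} := by
  ext B
  have hmem : B ∈ (commutant (weightedShift e w) : Set (H →L[ℂ] H)) ↔
      weightedShift e w * B = B * weightedShift e w := by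
    simp [commutant, Set.mem_centralizer_iff]
  rw [hmem]
  exact ⟨exists_hasSymbol_of_commute h hw0, fun ⟨a, ha⟩ =>
    (hasSymbol_weightedShift h).commute ha⟩

/-- The commutant is commutative, which gives one inclusion; the other holds because `T` lies in its
own commutant. -/
theorem commutant_eq_doubleCommutant_weightedShift (h : ∃ C : ℝ, ∀ n, |w n| ≤ C)
    (hw0 : ∀ n, w n ≠ 0) :
    commutant (weightedShift e w) = doubleCommutant (weightedShift e w) := by
  refine le_antisymm (fun B hB => ?_) ?_
  · refine (Subalgebra.mem_centralizer_iff ℂ).2 fun A hA => ?_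
    rw [coe_commutant_weightedShift h hw0] at hA
    have hB' : B ∈ (commutant (weightedShift e w) : Set (H →L[ℂ] H)) := hB
    rw [coe_commutant_weightedShift h hw0] at hB'
    exact hA.choose_spec.commute hB'.choose_spec
  · refine Subalgebra.centralizer_le _ _ _ ?_
    rw [Set.singleton_subset_iff, coe_commutant_weightedShift h hw0]
    exact ⟨_, hasSymbol_weightedShift h⟩

theorem range_calculus (hw : ∀ j, |w j| ≤ 1) (hruns : HasUnitRuns w) (hw0 : ∀ n, w n ≠ 0) :
    (calculus e hw).range = commutant (weightedShift e w) := by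
  apply SetLike.coe_injective
  rw [coe_commutant_weightedShift ⟨1, hw⟩ hw0]
  ext B
  exact ⟨fun ⟨f, hf⟩ => ⟨_, hf ▸ hasSymbol_calculus hw f⟩, fun ⟨_, ha⟩ =>
    ha.exists_calculus_eq hw hruns⟩

end Commutant

end RandomShift

/-! ### The theorem for random weights -/

/-- Weights and basis vectors are indexed from `0`: the shift `T ω` maps `e n` to
`X n ω • e (n + 1)`. -/
theorem theorem8p1 {Ω : Type*} [MeasurableSpace Ω] (P : Measure Ω) [IsProbabilityMeasure P]
    {H : Type*} [NormedAddCommGroup H] [InnerProductSpace ℂ H] [CompleteSpace H]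
    (e : HilbertBasis ℕ ℂ H) (X : ℕ → Ω → ℝ)
    (hmeas : ∀ n, Measurable (X n))
    (hnonneg : ∀ n, ∀ᵐ ω ∂P, 0 ≤ X n ω)
    (hindep : iIndepFun X P)
    (hident : ∀ n, IdentDistrib (X n) (X 0) P P)
    (hR : IsGreatest (RandomShift.essRange (X 0) P) 1)
    (T : Ω → H →L[ℂ] H)
    (hT : ∀ ω, T ω = RandomShift.weightedShift e (fun n => X n ω)) :
    (∀ᵐ ω ∂P, ∃ φ : RandomShift.banachAlgebraGen (T ω) ≃ₐ[ℂ] RandomShift.diskAlgebra,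
      Isometry φ) ∧
    (∀ᵐ ω ∂P,
      RandomShift.dualAlgebraGen e (T ω) = RandomShift.weaklyClosedAlgebraGen (T ω)) ∧
    (P {ω | X 0 ω = 0} = 0 →
      ∀ᵐ ω ∂P,
        RandomShift.dualAlgebraGen e (T ω) = RandomShift.weaklyClosedAlgebraGen (T ω) ∧
        RandomShift.weaklyClosedAlgebraGen (T ω) =
          (RandomShift.commutant (T ω) : Set (H →L[ℂ] H)) ∧
        RandomShift.commutant (T ω) = RandomShift.doubleCommutant (T ω) ∧
        ∃ φ : RandomShift.commutant (T ω) ≃ₐ[ℂ] RandomShift.hardyInfty, Isometry φ) := by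
  have hruns := RandomShift.ae_hasUnitRuns hmeas hindep hident hR.1
  have hle := RandomShift.ae_le_of_isGreatest_essRange hmeas hident hR
  have hbd : ∀ᵐ ω ∂P, ∀ n, |X n ω| ≤ 1 := by
    filter_upwards [hle, ae_all_iff.2 hnonneg] with ω h1 h2 n
    exact abs_le.2 ⟨by linarith [h2 n], h1 n⟩
  refine ⟨?_, ?_, fun h0 => ?_⟩
  · filter_upwards [hruns, hbd] with ω hr hw
    rw [hT]
    exact RandomShift.exists_isometric_algEquiv
      ((RandomShift.calculus e hw).comp RandomShift.restrictDisk)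
      ((RandomShift.isometry_calculus hw hr).comp RandomShift.isometry_restrictDisk)
      (RandomShift.range_calculus_comp_restrictDisk hw hr)
  · filter_upwards [hruns, hbd] with ω hr hw
    rw [hT, RandomShift.dualAlgebraGen_weightedShift hw hr,
      RandomShift.weaklyClosedAlgebraGen_weightedShift hw hr]
  · filter_upwards [hruns, hbd, RandomShift.ae_ne_of_measure_eq_zero hident h0] with ω hr hw hne
    rw [hT]
    refine ⟨?_, ?_, RandomShift.commutant_eq_doubleCommutant_weightedShift ⟨1, hw⟩ hne,
      RandomShift.exists_isometric_algEquiv _ (RandomShift.isometry_calculus hw hr)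
        (RandomShift.range_calculus hw hr hne)⟩
    · rw [RandomShift.dualAlgebraGen_weightedShift hw hr,
        RandomShift.weaklyClosedAlgebraGen_weightedShift hw hr]
    · rw [RandomShift.weaklyClosedAlgebraGen_weightedShift hw hr,
        RandomShift.coe_commutant_weightedShift ⟨1, hw⟩ hne]
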